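/- **Model.** Let $N_c\ge 1$ and $0<R_1<\dots<R_{N_c}$. Work under the conditional law given that the target's $N_c$ nearest base stations (BSs) are at distances $\mathbf R=(R_1,\dots,R_{N_c})$; BS 1 is the sensing BS. The parameters are $\lambda_{BS},\theta_b,G_m,\lambda,C_L,C_N,m_L,m_N,\eta_b,P_s,\sigma_{mono},\sigma_{bi},K_B,T,W>0$, $P_c,\zeta_{SI}\ge0$, an integer $N_b\ge1$ with $N_b\theta_b\le 2\pi$, path-loss exponents $\alpha_L>0$, $\alpha_N>2$, and a threshold $\tau>0$. Put $$p_{LOS}(r)=e^{-\eta_b r},\qquad p_n=p_{LOS}(R_n)\tfrac{N_b\theta_b}{2\pi},\qquad \lambda_I=\lambda_{BS}N_b\big(\tfrac{\theta_b}{2\pi}\big)^2,\qquad \xi=2\pi\lambda_I .$$ The following are independent. * Exponential radar cross sections $\sigma_m$ (mean $\sigma_{mono}$) and $\sigma_{b,n}$ (mean $\sigma_{bi}$), and events $C_n$ with $\mathbb P(C_n)=p_n$, $2\le n\le N_c$. * An exclusion radius $R_{N_c+1}$ with density $$f_T(r)=\tfrac{2(\pi\lambda_{BS})^{N_c}}{(N_c-1)!}(r^2-R_1^2)^{N_c-1}\,r\,e^{-\pi\lambda_{BS}(r^2-R_1^2)}\quad\text{on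 } r\ge R_1 .$$ * An exclusion radius $R_I$ with density $f_I(r)=2\pi\lambda_{BS}\,r\,e^{-\pi\lambda_{BS}r^2}$ on $r>0$. * Planar Poisson processes $\Phi_T,\Phi_L,\Phi_N$ with intensities $\lambda_{BS}\,p_{LOS}(|x|)\tfrac{N_b\theta_b}{2\pi}$, $p_{LOS}(|x|)\lambda_I$ and $(1-p_{LOS}(|x|))\lambda_I$. Their points carry i.i.d. marks independent of the points: $\sigma_x$ exponential with mean $\sigma_{bi}$ for $\Phi_T$; Gamma gains $g_x$ of mean $1$ and shape $m_L$ for $\Phi_L$, and shape $m_N$ for $\Phi_N$. Define $$P_{tot}=\tfrac{P_sG_m^2\lambda^2}{(4\pi)^3R_1^{2\alpha_L}}\sigma_m+\sum_{n=2}^{N_c}\mathbf 1_{C_n}\tfrac{P_sG_m^2\lambda^2}{(4\pi)^3R_1^{\alpha_L}R_n^{\alpha_L}}\sigma_{b,n},$$ $$I_T=\tfrac{P_sG_m^2\lambda^2}{(4\pi)^3R_1^{\alpha_L}}\sum_{x\in\Phi_T,\,|x|\ge R_{N_c+1}}\sigma_x|x|^{-\alpha_L},$$ $$I_{LS}=P_cG_m^2C_L\sum_{x\in\Phi_L,\,|x|\ge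 R_I}g_x|x|^{-\alpha_L},\qquad I_{NS}=P_cG_m^2C_N\sum_{x\in\Phi_N,\,|x|\ge R_I}g_x|x|^{-\alpha_N},$$ $$I_{tot}=I_T+I_{LS}+I_{NS}+K_BTW+P_c\zeta_{SI},\qquad \mathrm{SINR}_S=P_{tot}/I_{tot},$$ $$k=\frac{\mathbb E[P_{tot}]^2}{\mathrm{Var}(P_{tot})},\quad\theta=\frac{\mathrm{Var}(P_{tot})}{\mathbb E[P_{tot}]},\quad\eta=\Gamma(1+k)^{-1/k},\quad s_z=\frac{z\eta\tau}{\theta},\quad A(x)=1-\big(1-e^{-\eta x/\theta}\big)^{k}.$$ Let $G$ be a Gamma variable with shape $k$ and scale $\theta$, independent of $I_{tot}$. **Theorem.** 1. The interference sums converge almost surely. $P_{tot}$ is square integrable with $$\mathbb E[P_{tot}]=\mu_{1}+\sum_{n=2}^{N_c}p_n\mu_n,\qquad \mathrm{Var}(P_{tot})=\mu_1^2+\sum_{n=2}^{N_c}p_n(2-p_n)\mu_n^2,$$ where $\mu_1=\frac{P_sG_m^2\lambda^2\sigma_{mono}}{(4\pi)^3R_1^{2\alpha_L}}$ and $\mu_n=\frac{P_sG_m^2\lambda^2\sigma_{bi}}{(4\pi)^3R_1^{\alpha_L}R_n^{\alpha_L}}$.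 Moreover $k,\theta>0$, and $G$ has the mean and the variance of $P_{tot}$. 2. For all $s\ge0$, $$\mathcal L_{I_T}(s):=\mathbb E[e^{-sI_T}]=\int_{R_1}^\infty\exp\Big(-\lambda_{BS}N_b\theta_b\int_{\rho}^\infty p_{LOS}(r)\Big(1-\Big(1+\tfrac{sP_sG_m^2\lambda^2\sigma_{bi}}{(4\pi)^3R_1^{\alpha_L}r^{\alpha_L}}\Big)^{-1}\Big)r\,dr\Big)f_T(\rho)\,d\rho,$$ $$\mathcal L_{I_{LS}}\mathcal L_{I_{NS}}(s):=\mathbb E[e^{-s(I_{LS}+I_{NS})}]=\int_0^\infty e^{-\xi[J_L(s,\rho)+J_N(s,\rho)]}f_I(\rho)\,d\rho,$$ where $$J_L(s,\rho)=\int_\rho^\infty p_{LOS}(r)\Big[1-\Big(1+\tfrac{sP_cG_m^2C_Lr^{-\alpha_L}}{m_L}\Big)^{-m_L}\Big]r\,dr,$$ $$J_N(s,\rho)=\int_\rho^\infty(1-p_{LOS}(r))\Big[1-\Big(1+\tfrac{sP_cG_m^2C_Nr^{-\alpha_N}}{m_N}\Big)^{-m_N}\Big]r\,dr .$$ For a fixed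 exclusion radius $\rho>0$ in place of $R_I$, the Laplace transforms at $s$ of the LoS and of the NLoS sum are $e^{-\xi J_L(s,\rho)}$ and $e^{-\xi J_N(s,\rho)}$. 3. With $F(x)=\mathbb P(P_{tot}>x)$, $$\mathbb P(\mathrm{SINR}_S>\tau)=\mathbb E[F(\tau I_{tot})],\qquad \mathbb P(G/I_{tot}>\tau)=\mathbb E\big[\mathbb P(G>x)\big|_{x=\tau I_{tot}}\big].$$ For all $x\ge0$, $\mathbb P(G>x)\le A(x)$ if $k\ge1$ and $\mathbb P(G>x)\ge A(x)$ if $k\le1$. Almost surely $A(\tau I_{tot})=\sum_{z\ge1}\binom kz(-1)^{z+1}e^{-s_zI_{tot}}$. 4. The series $$S=\sum_{z=1}^\infty\binom kz(-1)^{z+1}\,\mathcal L_{I_T}(s_z)\,\mathcal L_{I_{LS}}\mathcal L_{I_{NS}}(s_z)\,e^{-s_zK_BTW}\,e^{-s_zP_c\zeta_{SI}}$$ converges absolutely and $S=\mathbb E[A(\tau I_{tot})]$. 5. $S$ approximates the coverage in the following sense: $\mathbb P(G/I_{tot}>\tau)\le S$ if $k\ge1$, and $\mathbb P(G/I_{tot}>\tau)\ge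 S$ if $k\le1$; and if $|F(x)-\mathbb P(G>x)|\le\varepsilon_1$ and $|\mathbb P(G>x)-A(x)|\le\varepsilon_2$ for all $x>0$, then $|\mathbb P(\mathrm{SINR}_S>\tau)-S|\le\varepsilon_1+\varepsilon_2$. -/

import Mathlib

open MeasureTheory ProbabilityTheory Set
open scoped ENNReal NNReal

noncomputable section

namespace CoopSensing

/-- The plane in which the base stations (BSs) are located, with its Euclidean norm. -/
abbrev Plane : Type := EuclideanSpace ℝ (Fin 2)

/-- Deterministic parameters of the network. -/
structure Params where
  /-- density of the BSs -/
  lamBS : ℝ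
  /-- number of beams of a BS -/
  Nb : ℕ
  /-- 3-dB beamwidth -/
  thetaB : ℝ
  /-- maximal antenna gain -/
  Gm : ℝ
  /-- wavelength -/
  wl : ℝ
  /-- LoS path-loss exponent -/
  aL : ℝ
  /-- NLoS path-loss exponent -/
  aN : ℝ
  /-- LoS path-loss intercept -/
  CL : ℝ
  /-- NLoS path-loss intercept -/
  CN : ℝ
  /-- LoS Nakagami parameter -/
  mL : ℝ
  /-- NLoS Nakagami parameter -/
  mN : ℝ
  /-- blockage parameter -/
  etaB : ℝ
  /-- sensing power -/
  Ps : ℝ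
  /-- communication power -/
  Pc : ℝ
  /-- mean monostatic radar cross section -/
  rcsMono : ℝ
  /-- mean bistatic radar cross section -/
  rcsBi : ℝ
  /-- Boltzmann constant -/
  KB : ℝ
  /-- temperature -/
  T : ℝ
  /-- bandwidth -/
  W : ℝ
  /-- residual self-interference fraction -/
  zetaSI : ℝ

/-- The ranges of the parameters. -/
structure Params.Valid (p : Params) : Prop where
  lamBS_pos : 0 < p.lamBS
  Nb_pos : 1 ≤ p.Nb
  thetaB_pos : 0 < p.thetaB
  /-- the beams of a BS do not overlap -/
  beams_le : p.Nb * p.thetaB ≤ 2 * Real.pi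
  Gm_pos : 0 < p.Gm
  wl_pos : 0 < p.wl
  aL_pos : 0 < p.aL
  two_lt_aN : 2 < p.aN
  CL_pos : 0 < p.CL
  CN_pos : 0 < p.CN
  mL_pos : 0 < p.mL
  mN_pos : 0 < p.mN
  etaB_pos : 0 < p.etaB
  Ps_pos : 0 < p.Ps
  Pc_nonneg : 0 ≤ p.Pc
  rcsMono_pos : 0 < p.rcsMono
  rcsBi_pos : 0 < p.rcsBi
  KB_pos : 0 < p.KB
  T_pos : 0 < p.T
  W_pos : 0 < p.W
  zetaSI_nonneg : 0 ≤ p.zetaSI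

namespace Params

variable (p : Params)

/-- Probability that a link of length `r` is LoS. -/
def pLOS (r : ℝ) : ℝ := Real.exp (-(p.etaB * r))

/-- Probability that a BS at distance `r` has a LoS link to the target and illuminates it. -/
def pLit (r : ℝ) : ℝ := p.pLOS r * (p.Nb * p.thetaB / (2 * Real.pi))

/-- Density of the BSs one of whose beams is aligned with the sensing beam. -/
def lamI : ℝ :=
  p.lamBS * (p.Nb * p.thetaB / (2 * Real.pi)) * (p.thetaB / (2 * Real.pi))

/-- Monostatic echo power per unit radar cross section, for a target at distance `R₁`. -/
def echoMono (R₁ : ℝ) : ℝ :=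
  p.Ps * p.Gm ^ 2 * p.wl ^ 2 / ((4 * Real.pi) ^ 3 * R₁ ^ (2 * p.aL))

/-- Bistatic echo power per unit radar cross section, for BSs at distances `R₁` and `R`. -/
def echoBi (R₁ R : ℝ) : ℝ :=
  p.Ps * p.Gm ^ 2 * p.wl ^ 2 / ((4 * Real.pi) ^ 3 * R₁ ^ p.aL * R ^ p.aL)

/-- Mean monostatic echo power. -/
def muMono (R₁ : ℝ) : ℝ := p.echoMono R₁ * p.rcsMono

/-- Mean bistatic echo power. -/
def muBi (R₁ R : ℝ) : ℝ := p.echoBi R₁ R * p.rcsBi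

/-- Density of the radius `R_I` of the exclusion disk for co-channel interference. -/
def densRI (r : ℝ) : ℝ :=
  if 0 < r then 2 * Real.pi * p.lamBS * r * Real.exp (-(Real.pi * p.lamBS * r ^ 2)) else 0

/-- Density of the distance from the target to its `(N_c + 1)`-th nearest BS, where
`N_c = K + 1`, given that the nearest BS is at distance `R₁`. -/
def densRT (K : ℕ) (R₁ r : ℝ) : ℝ :=
  if R₁ ≤ r then
    2 * (Real.pi * p.lamBS) ^ (K + 1) / (K.factorial : ℝ) * (r ^ 2 - R₁ ^ 2) ^ K * r *
      Real.exp (-(Real.pi * p.lamBS * (r ^ 2 - R₁ ^ 2)))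
  else 0

/-- LoS exponent functional. -/
def JL (s R : ℝ) : ℝ :=
  ∫ r in Ioi R, p.pLOS r *
    (1 - (1 + s * p.Pc * p.Gm ^ 2 * p.CL * r ^ (-p.aL) / p.mL) ^ (-p.mL)) * r

/-- NLoS exponent functional. -/
def JN (s R : ℝ) : ℝ :=
  ∫ r in Ioi R, (1 - p.pLOS r) *
    (1 - (1 + s * p.Pc * p.Gm ^ 2 * p.CN * r ^ (-p.aN) / p.mN) ^ (-p.mN)) * r

/-- The constant `ξ = 2 π λ_BS N_b (θ_b / 2π)²`. -/
def xi : ℝ := 2 * Real.pi * p.lamBS * p.Nb * (p.thetaB / (2 * Real.pi)) ^ 2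

/-- Closed form of the Laplace transform of the aggregate co-channel interference, which the
product notation `𝓛_{I_LS}(s) 𝓛_{I_NS}(s)` stands for: the product of the two transforms given
`R_I`, averaged over `R_I`. -/
def ltDirect (s : ℝ) : ℝ :=
  ∫ R in Ioi (0 : ℝ), Real.exp (-(p.xi * (p.JL s R + p.JN s R))) * p.densRI R

/-- Closed form of the Laplace transform of the target-reflected interference. -/
def ltTarget (K : ℕ) (R₁ s : ℝ) : ℝ :=
  ∫ R in Ioi R₁,
    Real.exp (-(p.lamBS * p.Nb * p.thetaB *
      ∫ r in Ioi R, p.pLOS r * (1 - 1 / (1 + s * p.muBi R₁ r)) * r)) * p.densRT K R₁ R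

end Params

/-- The three processes of interferers: BSs outside the cluster that illuminate the target (their
positions are relative to the target), and the aligned LoS and NLoS interferers (their positions
are relative to the sensing BS). -/
inductive Kind where
  | target
  | los
  | nlos

/-- Intensity measure of each process of interferers. -/
def Params.intensity (p : Params) : Kind → Measure Plane
  | .target => volume.withDensity fun x =>
      ENNReal.ofReal (p.lamBS * p.pLOS ‖x‖ * (p.Nb * p.thetaB / (2 * Real.pi)))
  | .los => volume.withDensity fun x => ENNReal.ofReal (p.pLOS ‖x‖ * p.lamI)
  | .nlos => volume.withDensity fun x => ENNReal.ofReal ((1 - p.pLOS ‖x‖) * p.lamI)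

/-- Law of the random factor of each interferer: an exponential radar cross section, or a
unit-mean Gamma fading gain. -/
def Params.markLaw (p : Params) : Kind → Measure ℝ
  | .target => expMeasure (1 / p.rcsBi)
  | .los => gammaMeasure p.mL p.mL
  | .nlos => gammaMeasure p.mN p.mN

/-- Path-loss exponent for each process of interferers. -/
def Params.exponent (p : Params) : Kind → ℝ
  | .target => p.aL
  | .los => p.aL
  | .nlos => p.aN

/-- Constant factor of each interference term. -/
def Params.amplitude (p : Params) (R₁ : ℝ) : Kind → ℝ
  | .target => p.Ps * p.Gm ^ 2 * p.wl ^ 2 / ((4 * Real.pi) ^ 3 * R₁ ^ p.aL)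
  | .los => p.Pc * p.Gm ^ 2 * p.CL
  | .nlos => p.Pc * p.Gm ^ 2 * p.CN

/-- A random measure `N` is a Poisson point process with intensity measure `Λ`: the mass of a set
of finite intensity is Poisson distributed, and masses of disjoint sets are independent. -/
structure IsPoissonPP {Ω X : Type*} [MeasurableSpace Ω] [MeasurableSpace X]
    (N : Ω → Measure X) (Λ : Measure X) (P : Measure Ω) : Prop where
  measurable : Measurable N
  poisson : ∀ A : Set X, MeasurableSet A → Λ A ≠ ∞ →
    HasLaw (fun ω => N ω A) ((poissonMeasure (Λ A).toNNReal).map fun n : ℕ => (n : ℝ≥0∞)) P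
  indep : ∀ (n : ℕ) (A : Fin n → Set X), (∀ i, MeasurableSet (A i)) →
    Pairwise (fun i j => Disjoint (A i) (A j)) → iIndepFun (fun i ω => N ω (A i)) P

/-- The random objects of the model, for a cluster of `N_c = K + 1` BSs: the sensing BS and `K`
candidate cooperating BSs. -/
structure Network (K : ℕ) (Ω : Type*) where
  /-- monostatic radar cross section -/
  rcsMono : Ω → ℝ
  /-- bistatic radar cross sections of the candidate cooperating BSs -/
  rcsBi : Fin K → Ω → ℝ
  /-- the event that a candidate BS has a LoS link to the target and illuminates it -/
  lit : Fin K → Set Ω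
  /-- distance to the first BS outside the cluster (exclusion radius around the target) -/
  radT : Ω → ℝ
  /-- exclusion radius around the sensing BS -/
  radI : Ω → ℝ
  /-- (possibly infinite) number of points of each process of interferers -/
  count : Kind → Ω → ℕ∞
  /-- positions of the interferers, of which the first `count` ones are used -/
  pos : Kind → ℕ → Ω → Plane
  /-- random factor (radar cross section or fading gain) of each interferer -/
  mark : Kind → ℕ → Ω → ℝ

/-- Labels of the independent sources of randomness. -/
inductive Source (K : ℕ) where
  | mono
  | bi (n : Fin K)
  | lit (n : Fin K)
  | radT
  | radI
  | points (j : Kind)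
  | mark (j : Kind) (i : ℕ)

namespace Network

variable {K : ℕ} {Ω : Type*}

/-- The counting measure of a process of interferers. -/
def pointMeasure (M : Network K Ω) (j : Kind) (ω : Ω) : Measure Plane :=
  open Classical in
  Measure.sum fun i : ℕ => if (i : ℕ∞) < M.count j ω then Measure.dirac (M.pos j i ω) else 0

/-- The σ-algebra generated by a source of randomness. -/
def sigma (M : Network K Ω) : Source K → MeasurableSpace Ω
  | .mono => MeasurableSpace.comap M.rcsMono inferInstance
  | .bi n => MeasurableSpace.comap (M.rcsBi n) inferInstance
  | .lit n => MeasurableSpace.generateFrom {M.lit n}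
  | .radT => MeasurableSpace.comap M.radT inferInstance
  | .radI => MeasurableSpace.comap M.radI inferInstance
  | .points j => MeasurableSpace.comap (fun ω => (M.count j ω, fun i => M.pos j i ω)) inferInstance
  | .mark j i => MeasurableSpace.comap (M.mark j i) inferInstance

/-- `P` is the law of the network conditioned on the distances `R = (R 0, …, R K)` from the target
to its `K + 1` nearest BSs. -/
structure IsModel [MeasurableSpace Ω] (M : Network K Ω) (p : Params) (R : Fin (K + 1) → ℝ)
    (P : Measure Ω) : Prop where
  measurable_rcsMono : Measurable M.rcsMono
  measurable_rcsBi : ∀ n, Measurable (M.rcsBi n)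
  measurable_lit : ∀ n, MeasurableSet (M.lit n)
  measurable_radT : Measurable M.radT
  measurable_radI : Measurable M.radI
  measurable_count : ∀ j, Measurable (M.count j)
  measurable_pos : ∀ j i, Measurable (M.pos j i)
  measurable_mark : ∀ j i, Measurable (M.mark j i)
  law_rcsMono : HasLaw M.rcsMono (expMeasure (1 / p.rcsMono)) P
  law_rcsBi : ∀ n, HasLaw (M.rcsBi n) (expMeasure (1 / p.rcsBi)) P
  prob_lit : ∀ n, P.real (M.lit n) = p.pLit (R n.succ)
  law_radT : HasLaw M.radT
    (volume.withDensity fun r => ENNReal.ofReal (p.densRT K (R 0) r)) P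
  law_radI : HasLaw M.radI (volume.withDensity fun r => ENNReal.ofReal (p.densRI r)) P
  poisson : ∀ j, IsPoissonPP (M.pointMeasure j) (p.intensity j) P
  law_mark : ∀ j i, HasLaw (M.mark j i) (p.markLaw j) P
  indep : iIndep M.sigma P

/-- Total echo power received by the sensing BS. -/
def Ptot (M : Network K Ω) (p : Params) (R : Fin (K + 1) → ℝ) (ω : Ω) : ℝ :=
  p.echoMono (R 0) * M.rcsMono ω +
    ∑ n : Fin K, (M.lit n).indicator (fun ω => p.echoBi (R 0) (R n.succ) * M.rcsBi n ω) ω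

/-- Contribution of the `i`-th point to an interference sum over points at distance at least
`d`. -/
def interfTerm (M : Network K Ω) (p : Params) (j : Kind) (d : ℝ) (ω : Ω) (i : ℕ) : ℝ :=
  open Classical in
  if (i : ℕ∞) < M.count j ω ∧ d ≤ ‖M.pos j i ω‖ then
    M.mark j i ω * ‖M.pos j i ω‖ ^ (-p.exponent j) else 0

/-- Interference from the points at distance at least `d`. -/
def interf (M : Network K Ω) (p : Params) (R : Fin (K + 1) → ℝ) (j : Kind) (d : ℝ) (ω : Ω) : ℝ :=
  p.amplitude (R 0) j * ∑' i, M.interfTerm p j d ω i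

/-- The exclusion radius that applies to each process of interferers. -/
def radius (M : Network K Ω) : Kind → Ω → ℝ
  | .target => M.radT
  | .los => M.radI
  | .nlos => M.radI

/-- Target-reflected interference. -/
def IT (M : Network K Ω) (p : Params) (R : Fin (K + 1) → ℝ) (ω : Ω) : ℝ :=
  M.interf p R .target (M.radius .target ω) ω

/-- LoS co-channel interference. -/
def ILS (M : Network K Ω) (p : Params) (R : Fin (K + 1) → ℝ) (ω : Ω) : ℝ :=
  M.interf p R .los (M.radius .los ω) ω

/-- NLoS co-channel interference. -/
def INS (M : Network K Ω) (p : Params) (R : Fin (K + 1) → ℝ) (ω : Ω) : ℝ :=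
  M.interf p R .nlos (M.radius .nlos ω) ω

/-- Total interference plus noise plus residual self-interference. -/
def Itot (M : Network K Ω) (p : Params) (R : Fin (K + 1) → ℝ) (ω : Ω) : ℝ :=
  M.IT p R ω + M.ILS p R ω + M.INS p R ω + p.KB * p.T * p.W + p.Pc * p.zetaSI

/-- The sensing SINR. -/
def sinr (M : Network K Ω) (p : Params) (R : Fin (K + 1) → ℝ) (ω : Ω) : ℝ :=
  M.Ptot p R ω / M.Itot p R ω

variable [MeasurableSpace Ω]

/-- Conditional sensing coverage probability. -/
def coverage (M : Network K Ω) (p : Params) (R : Fin (K + 1) → ℝ) (P : Measure Ω) (τ : ℝ) : ℝ :=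
  P.real {ω | τ < M.sinr p R ω}

/-- Moment-matched shape parameter. -/
def kEff (M : Network K Ω) (p : Params) (R : Fin (K + 1) → ℝ) (P : Measure Ω) : ℝ :=
  (∫ ω, M.Ptot p R ω ∂P) ^ 2 / variance (M.Ptot p R) P

/-- Moment-matched scale parameter. -/
def thetaEff (M : Network K Ω) (p : Params) (R : Fin (K + 1) → ℝ) (P : Measure Ω) : ℝ :=
  variance (M.Ptot p R) P / ∫ ω, M.Ptot p R ω ∂P

/-- The Gamma law that replaces the law of `Ptot` (Mathlib's second parameter is the rate). -/
def gammaLaw (M : Network K Ω) (p : Params) (R : Fin (K + 1) → ℝ) (P : Measure Ω) : Measure ℝ :=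
  gammaMeasure (M.kEff p R P) (M.thetaEff p R P)⁻¹

/-- Coverage probability when `Ptot` is replaced by an independent variable with the law
`gammaLaw`. -/
def gammaCoverage (M : Network K Ω) (p : Params) (R : Fin (K + 1) → ℝ) (P : Measure Ω)
    (τ : ℝ) : ℝ :=
  ((M.gammaLaw p R P).prod P).real {q | τ < q.1 / M.Itot p R q.2}

/-- The constant `η = Γ(1 + k)^(-1/k)`. -/
def eta (M : Network K Ω) (p : Params) (R : Fin (K + 1) → ℝ) (P : Measure Ω) : ℝ :=
  Real.Gamma (1 + M.kEff p R P) ^ (-(1 / M.kEff p R P))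

/-- Alzer's closed-form bound `1 - (1 - exp (-η x / θ))^k` for the Gamma tail at `x`. -/
def alzer (M : Network K Ω) (p : Params) (R : Fin (K + 1) → ℝ) (P : Measure Ω) (x : ℝ) : ℝ :=
  1 - (1 - Real.exp (-(M.eta p R P * x / M.thetaEff p R P))) ^ M.kEff p R P

/-- The arguments `s_z = z η τ / θ_eff`. -/
def sArg (M : Network K Ω) (p : Params) (R : Fin (K + 1) → ℝ) (P : Measure Ω) (τ : ℝ)
    (z : ℕ+) : ℝ :=
  (z : ℝ) * M.eta p R P * τ / M.thetaEff p R P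

/-- The `z`-th term of the series that approximates the coverage. -/
def coverageTerm (M : Network K Ω) (p : Params) (R : Fin (K + 1) → ℝ) (P : Measure Ω) (τ : ℝ)
    (z : ℕ+) : ℝ :=
  Ring.choose (M.kEff p R P) (z : ℕ) * (-1) ^ ((z : ℕ) + 1) *
    p.ltTarget K (R 0) (M.sArg p R P τ z) * p.ltDirect (M.sArg p R P τ z) *
    Real.exp (-(M.sArg p R P τ z * (p.KB * p.T * p.W))) *
    Real.exp (-(M.sArg p R P τ z * (p.Pc * p.zetaSI)))

end Network

/-- Laplace transform of a random variable. -/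
def laplace {Ω : Type*} [MeasurableSpace Ω] (P : Measure Ω) (X : Ω → ℝ) (s : ℝ) : ℝ :=
  ∫ ω, Real.exp (-(s * X ω)) ∂P

end CoopSensing

end

noncomputable section

namespace CoopSensing

/-! ### The Gamma law -/

section Gamma

variable {a r : ℝ}

/-! Every clause is an average over independent sources of randomness, obtained by freezing some of
them and integrating out the rest. The echo power uses only the cross sections and the illumination
events, and the interference uses only the other sources. By Fubini the coverage is therefore the
mean of the tail of the echo power at `τ * Itot` (`IsModel.coverage_eq`). Division by `Itot` is
harmless because noise keeps it positive. The moments of the echo power are those of independent,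
randomly switched exponentials, and the Gamma law is fitted to them.

Laplace transforms. On a simple function the Laplace functional of a Poisson process is a product
over level sets, which carry independent Poisson counts; monotone approximation gives the general
case (`IsPoissonPP.integral_exp_neg_lintegral`). For marked points, freezing the points and
averaging over the marks replaces each weight `f x` by the factor `ψ (f x)`, where `ψ` is the
Laplace transform of the mark law. This is an unmarked functional with weight `-log ψ(f)`
(`IsMarkedPoisson.integral_exp_neg_shotNoise`). Polar coordinates give the radial exponents, and the
independent exclusion radius is averaged out last. The two co-channel sums share one radius, so
their product stays under that integral, whereas the target-reflected factor splits off.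

Alzer's inequality. The Gamma density divided by the derivative of `(1 - exp (-b x))^k` is `exp (x *
G x)`. The function `G` is monotone by Jensen's inequality, in a direction decided by the sign of `k
- 1`. The densities thus cross at most once. Both have mass one, so their tails are ordered
(`alzer_inequality`).

Series. The binomial series expands Alzer's expression in powers of an exponential of `-Itot`, and
the mean of each power is a Laplace transform. Replacing the interference by its noise floor gives a
summable dominating series, so sum and mean commute (`IsModel.hasSum_coverageTerm`). The final
comparisons are pointwise bounds on tails, averaged over the interference. -/

theorem gammaMeasure_eq_withDensity_restrict (a r : ℝ) :
    gammaMeasure a r = (volume.restrict (Ioi 0)).withDensity fun x =>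
      ENNReal.ofReal (r ^ a / Real.Gamma a * x ^ (a - 1) * Real.exp (-(r * x))) := by
  rw [gammaMeasure, ← withDensity_indicator measurableSet_Ioi]
  apply withDensity_congr_ae
  -- The library density uses the closed half-line; the two versions can differ only at the null
  -- point `0`.
  filter_upwards [Measure.ae_ne volume (0 : ℝ)] with x hx
  rcases lt_or_gt_of_ne hx with h | h
  · simp [gammaPDF_of_neg h, indicator, h.le.not_gt]
  · simp [gammaPDF_of_nonneg h.le, indicator, h]

theorem gamma_density_nonneg (ha : 0 < a) (hr : 0 < r) {x : ℝ} (hx : 0 < x) :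
    0 ≤ r ^ a / Real.Gamma a * x ^ (a - 1) * Real.exp (-(r * x)) := by
  have := Real.Gamma_pos_of_pos ha
  positivity

theorem measurable_gamma_density (a r : ℝ) :
    Measurable fun x : ℝ => r ^ a / Real.Gamma a * x ^ (a - 1) * Real.exp (-(r * x)) := by
  fun_prop

theorem integral_gammaMeasure (ha : 0 < a) (hr : 0 < r) (f : ℝ → ℝ) :
    ∫ x, f x ∂gammaMeasure a r =
      ∫ x in Ioi 0, r ^ a / Real.Gamma a * x ^ (a - 1) * Real.exp (-(r * x)) * f x := by
  rw [gammaMeasure_eq_withDensity_restrict, integral_withDensity_eq_integral_toReal_smul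
    (measurable_gamma_density a r).ennreal_ofReal (by simp)]
  refine setIntegral_congr_fun measurableSet_Ioi fun x hx => ?_
  simp only [smul_eq_mul]
  rw [ENNReal.toReal_ofReal (gamma_density_nonneg ha hr hx)]

theorem integrable_gammaMeasure_iff (ha : 0 < a) (hr : 0 < r) (f : ℝ → ℝ) :
    Integrable f (gammaMeasure a r) ↔ IntegrableOn
      (fun x => r ^ a / Real.Gamma a * x ^ (a - 1) * Real.exp (-(r * x)) * f x) (Ioi 0) := by
  rw [gammaMeasure_eq_withDensity_restrict, integrable_withDensity_iff_integrable_smul'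
    (measurable_gamma_density a r).ennreal_ofReal (by simp)]
  refine integrableOn_congr_fun (fun x hx => ?_) measurableSet_Ioi
  simp only [smul_eq_mul]
  rw [ENNReal.toReal_ofReal (gamma_density_nonneg ha hr hx)]

theorem ae_gammaMeasure_pos (a r : ℝ) : ∀ᵐ x ∂gammaMeasure a r, 0 < x := by
  rw [gammaMeasure_eq_withDensity_restrict]
  exact (withDensity_absolutelyContinuous _ _).ae_le (ae_restrict_mem measurableSet_Ioi)

theorem integrableOn_rpow_mul_exp_neg_mul (ha : 0 < a) (hr : 0 < r) :
    IntegrableOn (fun x : ℝ => x ^ (a - 1) * Real.exp (-(r * x))) (Ioi 0) := by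
  -- A non-integrable function has Bochner integral `0`, so the positive value of the Gamma integral
  -- already proves integrability.
  refine Integrable.of_integral_ne_zero ?_
  rw [Real.integral_rpow_mul_exp_neg_mul_Ioi ha hr]
  have := Real.Gamma_pos_of_pos ha
  positivity

/-- The Laplace transform of the Gamma law. -/
theorem integral_exp_neg_gammaMeasure (ha : 0 < a) (hr : 0 < r) {c : ℝ} (hc : 0 ≤ c) :
    ∫ x, Real.exp (-(c * x)) ∂gammaMeasure a r = (1 + c / r) ^ (-a) := by
  rw [integral_gammaMeasure ha hr]
  have hG := Real.Gamma_pos_of_pos ha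
  have h : ∀ x : ℝ, r ^ a / Real.Gamma a * x ^ (a - 1) * Real.exp (-(r * x)) *
      Real.exp (-(c * x)) =
      r ^ a / Real.Gamma a * (x ^ (a - 1) * Real.exp (-((r + c) * x))) := fun x => by
    rw [mul_assoc (r ^ a / _ * _), ← Real.exp_add, mul_assoc]; ring_nf
  simp_rw [h]
  rw [integral_const_mul, Real.integral_rpow_mul_exp_neg_mul_Ioi ha (by positivity),
    show 1 + c / r = (r + c) / r by field_simp, Real.rpow_neg (by positivity),
    Real.div_rpow (by positivity) hr.le, Real.div_rpow (by positivity) (by positivity),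
    Real.one_rpow]
  field_simp

/-- A factor `x ^ q` only shifts the shape from `a` to `a + q`, so every moment reduces to a Gamma
integral. -/
theorem gamma_density_mul_rpow {x : ℝ} (hx : x ∈ Ioi 0) (q : ℝ) :
    r ^ a / Real.Gamma a * x ^ (a - 1) * Real.exp (-(r * x)) * x ^ q =
      r ^ a / Real.Gamma a * (x ^ (a + q - 1) * Real.exp (-(r * x))) := by
  rw [show a + q - 1 = (a - 1) + q by ring, Real.rpow_add hx]
  ring

theorem integrable_rpow_gammaMeasure (ha : 0 < a) (hr : 0 < r) {q : ℝ} (hq : 0 ≤ q) :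
    Integrable (fun x => x ^ q) (gammaMeasure a r) := by
  rw [integrable_gammaMeasure_iff ha hr]
  exact IntegrableOn.congr_fun ((integrableOn_rpow_mul_exp_neg_mul (by positivity) hr).const_mul _)
    (fun x hx => (gamma_density_mul_rpow hx q).symm) measurableSet_Ioi

theorem integral_rpow_gammaMeasure (ha : 0 < a) (hr : 0 < r) {q : ℝ} (hq : 0 ≤ q) :
    ∫ x, x ^ q ∂gammaMeasure a r = Real.Gamma (a + q) / (Real.Gamma a * r ^ q) := by
  have hG := Real.Gamma_pos_of_pos ha
  rw [integral_gammaMeasure ha hr, setIntegral_congr_fun measurableSet_Ioi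
    (fun x hx => gamma_density_mul_rpow hx q), integral_const_mul,
    Real.integral_rpow_mul_exp_neg_mul_Ioi (by positivity) hr, Real.div_rpow zero_le_one hr.le,
    Real.one_rpow, Real.rpow_add hr]
  field_simp

theorem integral_id_gammaMeasure (ha : 0 < a) (hr : 0 < r) :
    ∫ x, x ∂gammaMeasure a r = a / r := by
  have h := integral_rpow_gammaMeasure ha hr zero_le_one
  have hG := Real.Gamma_pos_of_pos ha
  simp only [Real.rpow_one] at h
  rw [h, Real.Gamma_add_one ha.ne']
  field_simp

theorem integral_sq_gammaMeasure (ha : 0 < a) (hr : 0 < r) :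
    ∫ x, x ^ 2 ∂gammaMeasure a r = a * (a + 1) / r ^ 2 := by
  have h := integral_rpow_gammaMeasure ha hr zero_le_two
  have hG := Real.Gamma_pos_of_pos ha
  simp only [Real.rpow_two] at h
  rw [h, show a + 2 = a + 1 + 1 by ring, Real.Gamma_add_one (by positivity),
    Real.Gamma_add_one ha.ne']
  field_simp

theorem memLp_id_gammaMeasure (ha : 0 < a) (hr : 0 < r) : MemLp id 2 (gammaMeasure a r) := by
  rw [memLp_two_iff_integrable_sq aestronglyMeasurable_id]
  simpa using integrable_rpow_gammaMeasure ha hr zero_le_two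

theorem variance_id_gammaMeasure (ha : 0 < a) (hr : 0 < r) :
    variance id (gammaMeasure a r) = a / r ^ 2 := by
  have := isProbabilityMeasure_gammaMeasure ha hr
  rw [variance_eq_sub (memLp_id_gammaMeasure ha hr)]
  simp only [Pi.pow_apply, id_eq]
  rw [integral_sq_gammaMeasure ha hr, integral_id_gammaMeasure ha hr]
  field_simp
  ring

theorem gammaMeasure_real_Ioi (ha : 0 < a) (hr : 0 < r) {x : ℝ} (hx : 0 ≤ x) :
    (gammaMeasure a r).real (Ioi x) =
      ∫ y in Ioi x, r ^ a / Real.Gamma a * y ^ (a - 1) * Real.exp (-(r * y)) := by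
  rw [measureReal_def, gammaMeasure_eq_withDensity_restrict, withDensity_apply _ measurableSet_Ioi,
    Measure.restrict_restrict measurableSet_Ioi, inter_eq_left.2 (Ioi_subset_Ioi hx),
    integral_eq_lintegral_of_nonneg_ae]
  · filter_upwards [ae_restrict_mem measurableSet_Ioi] with y hy
    exact gamma_density_nonneg ha hr (hx.trans_lt hy)
  · exact (measurable_gamma_density a r).aestronglyMeasurable

theorem integrableOn_gamma_density (ha : 0 < a) (hr : 0 < r) :
    IntegrableOn (fun y : ℝ => r ^ a / Real.Gamma a * y ^ (a - 1) * Real.exp (-(r * y)))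
      (Ioi 0) := by
  simp_rw [mul_assoc]
  exact (integrableOn_rpow_mul_exp_neg_mul ha hr).const_mul _

end Gamma

/-! ### Alzer's inequality for the Gamma tail -/

section Alzer

/-- Two densities with the same total mass, the first of which is larger near `0` and smaller
far away, have ordered tails. -/
theorem setIntegral_Ioi_le_of_crossing {f g : ℝ → ℝ} (hf : IntegrableOn f (Ioi 0))
    (hg : IntegrableOn g (Ioi 0)) (heq : ∫ x in Ioi 0, f x = ∫ x in Ioi 0, g x)
    (hcross : ∀ x, 0 < x → (∀ y, 0 < y → y ≤ x → g y ≤ f y) ∨ ∀ y, x < y → f y ≤ g y)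
    {x : ℝ} (hx : 0 ≤ x) : ∫ y in Ioi x, f y ≤ ∫ y in Ioi x, g y := by
  rcases hx.eq_or_lt with rfl | hx'
  · exact heq.le
  have hI : Ioi x ⊆ Ioi 0 := Ioi_subset_Ioi hx
  have hJ : Ioc 0 x ⊆ Ioi 0 := Ioc_subset_Ioi_self
  -- If the crossing lies beyond `x`, compare the masses on `(0, x]` and subtract from the equal
  -- totals; otherwise compare the tails directly.
  rcases hcross x hx' with h | h
  · have hsplit : ∀ u : ℝ → ℝ, IntegrableOn u (Ioi 0) →
        ∫ y in Ioi 0, u y = (∫ y in Ioc 0 x, u y) + ∫ y in Ioi x, u y := fun u hu => by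
      rw [← Ioc_union_Ioi_eq_Ioi hx, setIntegral_union Ioc_disjoint_Ioi_same measurableSet_Ioi
        (hu.mono_set hJ) (hu.mono_set hI)]
    have hle : ∫ y in Ioc 0 x, g y ≤ ∫ y in Ioc 0 x, f y :=
      setIntegral_mono_on (hg.mono_set hJ) (hf.mono_set hJ) measurableSet_Ioc
        fun y hy => h y hy.1 hy.2
    linarith [hsplit f hf, hsplit g hg]
  · exact setIntegral_mono_on (hf.mono_set hI) (hg.mono_set hI) measurableSet_Ioi fun y hy => h y hy

theorem integral_exp_neg_mul_unit {u : ℝ} (hu : 0 < u) :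
    ∫ t in (0 : ℝ)..1, Real.exp (-(u * t)) = (1 - Real.exp (-u)) / u := by
  have h := intervalIntegral.integral_comp_mul_left (fun t => Real.exp t) (a := 0) (b := 1)
    (c := -u) (by linarith)
  simp only [neg_mul, mul_zero, mul_one, integral_exp, Real.exp_zero, smul_eq_mul] at h
  rw [h]
  field_simp
  ring

theorem one_sub_exp_neg_div_pos {u : ℝ} (hu : 0 < u) : 0 < (1 - Real.exp (-u)) / u :=
  div_pos (by simpa using hu) hu

/-- Jensen's inequality for `∫₀¹ exp (-u t) dt = (1 - exp (-u)) / u`. -/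
theorem one_sub_exp_neg_div_le_rpow {y x : ℝ} (hy : 0 < y) (hyx : y ≤ x) :
    (1 - Real.exp (-y)) / y ≤ ((1 - Real.exp (-x)) / x) ^ (y / x) := by
  have hx : 0 < x := hy.trans_le hyx
  rw [← integral_exp_neg_mul_unit hy, ← integral_exp_neg_mul_unit hx,
    intervalIntegral.integral_of_le zero_le_one, intervalIntegral.integral_of_le zero_le_one]
  have hprob : IsProbabilityMeasure (volume.restrict (Ioc (0 : ℝ) 1)) := ⟨by simp⟩
  have hint : ∀ u : ℝ, Integrable (fun t : ℝ => Real.exp (-(u * t)))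
      (volume.restrict (Ioc (0 : ℝ) 1)) := fun u =>
    (Continuous.integrableOn_Icc (by fun_prop)).mono_set Ioc_subset_Icc_self
  have hpow : ∀ t : ℝ, Real.exp (-(x * t)) ^ (y / x) = Real.exp (-(y * t)) := fun t => by
    rw [← Real.exp_mul]; congr 1; field_simp
  -- Jensen for the concave power `t ^ (y / x)`, whose exponent is at most `1`, under the uniform
  -- law on `(0, 1]`; this power turns `exp (-(x * t))` into `exp (-(y * t))`.
  have hJ := (Real.concaveOn_rpow (p := y / x) (by positivity)
    ((div_le_one hx).2 hyx)).le_map_integral (μ := volume.restrict (Ioc (0 : ℝ) 1))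
    (f := fun t => Real.exp (-(x * t)))
    ((Real.continuous_rpow_const (by positivity)).continuousOn) isClosed_Ici
    (ae_of_all _ fun t => (Real.exp_pos _).le) (hint x)
    (by simpa only [Function.comp_def, hpow] using hint y)
  simpa only [hpow] using hJ

/-- The function `u ↦ log ((1 - exp (-u)) / u) / u` is monotone on `(0, ∞)`. -/
theorem log_one_sub_exp_neg_div_le {y x : ℝ} (hy : 0 < y) (hyx : y ≤ x) :
    Real.log ((1 - Real.exp (-y)) / y) / y ≤ Real.log ((1 - Real.exp (-x)) / x) / x := by
  have hx : 0 < x := hy.trans_le hyx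
  have h := Real.log_le_log (one_sub_exp_neg_div_pos hy) (one_sub_exp_neg_div_le_rpow hy hyx)
  rw [Real.log_rpow (one_sub_exp_neg_div_pos hx)] at h
  rw [div_le_iff₀ hy]
  calc _ ≤ _ := h
    _ = _ := by ring

variable {k b : ℝ}

/-- The density of the law with distribution function `(1 - exp (-b x))^k`. -/
def alzerDensity (k b x : ℝ) : ℝ := k * b * Real.exp (-(b * x)) * (1 - Real.exp (-(b * x))) ^ (k - 1)

theorem alzerDensity_pos (hk : 0 < k) (hb : 0 < b) {x : ℝ} (hx : 0 < x) :
    0 < alzerDensity k b x := by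
  have : 0 < 1 - Real.exp (-(b * x)) := by simpa using mul_pos hb hx
  unfold alzerDensity
  positivity

theorem hasDerivAt_one_sub_exp_rpow (hb : 0 < b) {x : ℝ} (hx : 0 < x) :
    HasDerivAt (fun x => (1 - Real.exp (-(b * x))) ^ k) (alzerDensity k b x) x := by
  have h0 : 0 < 1 - Real.exp (-(b * x)) := by simpa using mul_pos hb hx
  have h1 : HasDerivAt (fun x => 1 - Real.exp (-(b * x))) (b * Real.exp (-(b * x))) x := by
    have := ((hasDerivAt_const_mul b (x := x)).fun_neg.exp).const_sub 1
    exact this.congr_deriv (by ring)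
  convert h1.rpow_const (p := k) (Or.inl h0.ne') using 1
  unfold alzerDensity
  ring

theorem continuous_one_sub_exp_rpow (hk : 0 < k) (b : ℝ) :
    Continuous fun x : ℝ => (1 - Real.exp (-(b * x))) ^ k :=
  (Real.continuous_rpow_const hk.le).comp (by fun_prop)

theorem tendsto_one_sub_exp_rpow (hb : 0 < b) :
    Filter.Tendsto (fun x => (1 - Real.exp (-(b * x))) ^ k) Filter.atTop (nhds 1) := by
  have h : Filter.Tendsto (fun x => 1 - Real.exp (-(b * x))) Filter.atTop (nhds (1 - 0)) :=
    tendsto_const_nhds.sub (Real.tendsto_exp_neg_atTop_nhds_zero.comp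
      (Filter.tendsto_id.const_mul_atTop hb))
  simpa using h.rpow_const (p := k) (Or.inl (by norm_num))

theorem integrableOn_alzerDensity (hk : 0 < k) (hb : 0 < b) :
    IntegrableOn (alzerDensity k b) (Ioi 0) :=
  integrableOn_Ioi_deriv_of_nonneg (continuous_one_sub_exp_rpow hk b).continuousWithinAt
    (fun _ hx => hasDerivAt_one_sub_exp_rpow hb hx) (fun _ hx => (alzerDensity_pos hk hb hx).le)
    (tendsto_one_sub_exp_rpow hb)

theorem integral_alzerDensity (hk : 0 < k) (hb : 0 < b) {x : ℝ} (hx : 0 ≤ x) :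
    ∫ y in Ioi x, alzerDensity k b y = 1 - (1 - Real.exp (-(b * x))) ^ k :=
  integral_Ioi_of_hasDerivAt_of_nonneg (continuous_one_sub_exp_rpow hk b).continuousWithinAt
    (fun _ hy => hasDerivAt_one_sub_exp_rpow hb (hx.trans_lt hy))
    (fun _ hy => (alzerDensity_pos hk hb (hx.trans_lt hy)).le) (tendsto_one_sub_exp_rpow hb)

/-- Isolates the sign that decides which density is larger: apart from the factor `x`, the logarithm
of the ratio is affine in the monotone function of `log_one_sub_exp_neg_div_le`, with slope `-(k -
1) * b`. -/
theorem gamma_density_eq_mul_exp {r : ℝ} (hk : 0 < k) (hr : 0 < r)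
    (hb : b = Real.Gamma (1 + k) ^ (-(1 / k)) * r) {x : ℝ} (hx : 0 < x) :
    r ^ k / Real.Gamma k * x ^ (k - 1) * Real.exp (-(r * x)) = alzerDensity k b x *
      Real.exp (x * ((b - r) - (k - 1) * b *
        (Real.log ((1 - Real.exp (-(b * x))) / (b * x)) / (b * x)))) := by
  have hG := Real.Gamma_pos_of_pos hk
  have hG1 : 0 < Real.Gamma (1 + k) := Real.Gamma_pos_of_pos (by positivity)
  have hb0 : 0 < b := by rw [hb]; positivity
  -- This identity dictates the value of `η`: it makes the constant prefactors cancel, so the ratio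
  -- of the densities tends to `1` at `0`.
  have hbk : b ^ k = r ^ k / Real.Gamma (1 + k) := by
    rw [hb, Real.mul_rpow (by positivity) hr.le, ← Real.rpow_mul hG1.le,
      show -(1 / k) * k = -1 by field_simp, Real.rpow_neg_one]
    ring
  have hE : 0 < 1 - Real.exp (-(b * x)) := by simpa using mul_pos hb0 hx
  have hq : 0 < (1 - Real.exp (-(b * x))) / (b * x) := one_sub_exp_neg_div_pos (mul_pos hb0 hx)
  have hexp : Real.exp (x * ((b - r) - (k - 1) * b *
        (Real.log ((1 - Real.exp (-(b * x))) / (b * x)) / (b * x)))) =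
      Real.exp (b * x) * Real.exp (-(r * x)) *
        ((1 - Real.exp (-(b * x))) / (b * x)) ^ (-(k - 1)) := by
    rw [Real.rpow_def_of_pos hq, ← Real.exp_add, ← Real.exp_add]
    congr 1
    field_simp
    ring
  have hbk' : b ^ k = b * b ^ (k - 1) := by
    rw [Real.rpow_sub_one hb0.ne']; field_simp
  have hrk : r ^ k = k * Real.Gamma k * (b * b ^ (k - 1)) := by
    rw [← hbk', hbk, add_comm 1 k, Real.Gamma_add_one hk.ne']
    field_simp
  rw [hexp, alzerDensity, Real.rpow_neg hq.le, Real.div_rpow hE.le (by positivity),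
    Real.mul_rpow hb0.le hx.le, hrk,
    show Real.exp (b * x) = (Real.exp (-(b * x)))⁻¹ by rw [Real.exp_neg, inv_inv]]
  have h1 : (1 - Real.exp (-(b * x))) ^ (k - 1) ≠ 0 := by positivity
  have h2 : Real.exp (-(b * x)) ≠ 0 := Real.exp_ne_zero _
  generalize Real.exp (-(b * x)) = E at h1 h2
  generalize (1 - E) ^ (k - 1) = D at h1
  field_simp

/-- Alzer's inequality: the comparison of the tail of a Gamma law of shape `k` and rate `r` with
`1 - (1 - exp (-η r x))^k`, where `η = Γ(1 + k)^(-1/k)`. -/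
theorem alzer_inequality {r : ℝ} (hk : 0 < k) (hr : 0 < r)
    (hb : b = Real.Gamma (1 + k) ^ (-(1 / k)) * r) {x : ℝ} (hx : 0 ≤ x) :
    (1 ≤ k → (gammaMeasure k r).real (Ioi x) ≤ 1 - (1 - Real.exp (-(b * x))) ^ k) ∧
    (k ≤ 1 → 1 - (1 - Real.exp (-(b * x))) ^ k ≤ (gammaMeasure k r).real (Ioi x)) := by
  have hb0 : 0 < b := by
    have : 0 < Real.Gamma (1 + k) := Real.Gamma_pos_of_pos (by positivity)
    rw [hb]; positivity
  have hprob := isProbabilityMeasure_gammaMeasure hk hr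
  -- Both densities have total mass `1`, as the crossing argument requires.
  have htot : ∫ y in Ioi 0, r ^ k / Real.Gamma k * y ^ (k - 1) * Real.exp (-(r * y)) =
      ∫ y in Ioi 0, alzerDensity k b y := by
    rw [← gammaMeasure_real_Ioi hk hr le_rfl, integral_alzerDensity hk hb0 le_rfl]
    have h1 : (gammaMeasure k r).real (Ioi 0) = 1 := by
      rw [measureReal_def, (prob_compl_eq_zero_iff measurableSet_Ioi).1
        (ae_iff.1 (ae_gammaMeasure_pos k r))]
      rfl
    simp [h1, Real.zero_rpow hk.ne']
  set G : ℝ → ℝ := fun y => (b - r) - (k - 1) * b *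
    (Real.log ((1 - Real.exp (-(b * y))) / (b * y)) / (b * y)) with hGdef
  have hdens : ∀ {y : ℝ}, 0 < y → r ^ k / Real.Gamma k * y ^ (k - 1) * Real.exp (-(r * y)) =
      alzerDensity k b y * Real.exp (y * G y) := fun hy => gamma_density_eq_mul_exp hk hr hb hy
  have hle : ∀ {y : ℝ}, 0 < y → 0 ≤ G y →
      alzerDensity k b y ≤ r ^ k / Real.Gamma k * y ^ (k - 1) * Real.exp (-(r * y)) := by
    intro y hy h
    rw [hdens hy]
    exact le_mul_of_one_le_right (alzerDensity_pos hk hb0 hy).le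
      (Real.one_le_exp (mul_nonneg hy.le h))
  have hge : ∀ {y : ℝ}, 0 < y → G y ≤ 0 →
      r ^ k / Real.Gamma k * y ^ (k - 1) * Real.exp (-(r * y)) ≤ alzerDensity k b y := by
    intro y hy h
    rw [hdens hy]
    exact mul_le_of_le_one_right (alzerDensity_pos hk hb0 hy).le
      (Real.exp_le_one_iff.2 (mul_nonpos_of_nonneg_of_nonpos hy.le h))
  have hlog : ∀ {y z : ℝ}, 0 < y → y ≤ z → _ := fun {y z} hy hyz =>
    log_one_sub_exp_neg_div_le (mul_pos hb0 hy) (mul_le_mul_of_nonneg_left hyz hb0.le)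
  rw [← integral_alzerDensity hk hb0 hx, gammaMeasure_real_Ioi hk hr hx]
  constructor
  · intro hk1
    have hanti : ∀ {y z : ℝ}, 0 < y → y ≤ z → G z ≤ G y := fun hy hyz =>
      sub_le_sub_left (mul_le_mul_of_nonneg_left (hlog hy hyz)
        (mul_nonneg (by linarith) hb0.le)) _
    refine setIntegral_Ioi_le_of_crossing (integrableOn_gamma_density hk hr)
      (integrableOn_alzerDensity hk hb0) htot (fun z hz => ?_) hx
    -- As `G` is antitone, a nonnegative value at `z` propagates to `(0, z]` and a nonpositive one
    -- to `(z, ∞)`. For `k ≤ 1` both the monotonicity and the roles of the densities are reversed.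
    rcases le_total 0 (G z) with h | h
    · exact Or.inl fun y hy hyz => hle hy (h.trans (hanti hy hyz))
    · exact Or.inr fun y hzy => hge (hz.trans hzy) ((hanti hz hzy.le).trans h)
  · intro hk1
    have hmono : ∀ {y z : ℝ}, 0 < y → y ≤ z → G y ≤ G z := fun hy hyz =>
      sub_le_sub_left (mul_le_mul_of_nonpos_left (hlog hy hyz)
        (mul_nonpos_of_nonpos_of_nonneg (by linarith) hb0.le)) _
    refine setIntegral_Ioi_le_of_crossing (integrableOn_alzerDensity hk hb0)
      (integrableOn_gamma_density hk hr) htot.symm (fun z hz => ?_) hx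
    rcases le_total 0 (G z) with h | h
    · exact Or.inr fun y hzy => hle (hz.trans hzy) (h.trans (hmono hz hzy.le))
    · exact Or.inl fun y hy hyz => hge hy ((hmono hy hyz).trans h)

end Alzer

/-! ### The binomial series -/

section Binomial

theorem hasSum_choose_mul_pow (k : ℝ) {q : ℝ} (hq : |q| < 1) :
    HasSum (fun n : ℕ => Ring.choose k n * q ^ n) ((1 + q) ^ k) := by
  have h := (Real.one_add_rpow_hasFPowerSeriesOnBall_zero (a := k)).hasSum (y := q)
    (by simpa [enorm_eq_nnnorm, ← NNReal.coe_lt_coe] using hq)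
  simpa [binomialSeries, FormalMultilinearSeries.coeff_ofScalars, mul_comm] using h

/-- Negate the binomial series at `-q` and drop its constant term; the index then runs over positive
integers. -/
theorem hasSum_pnat_choose_mul_pow (k : ℝ) {q : ℝ} (hq : |q| < 1) :
    HasSum (fun z : ℕ+ => Ring.choose k (z : ℕ) * (-1) ^ ((z : ℕ) + 1) * q ^ (z : ℕ))
      (1 - (1 - q) ^ k) := by
  have h := (hasSum_choose_mul_pow k (q := -q) (by simpa using hq)).neg
  rw [← hasSum_nat_add_iff' 1] at h
  rw [← Equiv.pnatEquivNat.symm.hasSum_iff]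
  have h1 : 1 - (1 - q) ^ k =
      -(1 + -q) ^ k - ∑ i ∈ Finset.range 1, -(Ring.choose k i * (-q) ^ i) := by
    simp only [Finset.range_one, Finset.sum_singleton, Ring.choose_zero_right, pow_zero]
    ring_nf
  rw [h1]
  refine h.congr_fun fun n => ?_
  change Ring.choose k (n + 1) * (-1) ^ (n + 1 + 1) * q ^ (n + 1) = _
  rw [neg_pow q]
  ring

end Binomial

/-! ### Poisson processes: mean measure and Laplace functional -/

section Poisson

open Filter Topology

theorem lintegral_natCast_poissonMeasure (r : ℝ≥0) :
    ∫⁻ n : ℕ, (n : ℝ≥0∞) ∂poissonMeasure r = r := by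
  have hs : HasSum (fun n : ℕ => Real.exp (-r) * r ^ n / n.factorial * n) r := by
    -- The term `n = 0` vanishes; after the shift, `n + 1` cancels against the factorial and leaves
    -- `r` times the total mass.
    rw [← hasSum_nat_add_iff' 1]
    have h := (hasSum_one_poissonMeasure r).mul_right (r : ℝ)
    simp only [Finset.range_one, Finset.sum_singleton, Nat.cast_zero, mul_zero, sub_zero]
    rw [one_mul] at h
    refine h.congr_fun fun n => ?_
    rw [Nat.factorial_succ]
    push_cast
    field_simp
    ring
  rw [poissonMeasure, lintegral_sum_measure]
  simp_rw [lintegral_smul_measure, lintegral_dirac, smul_eq_mul]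
  have h : ∀ n : ℕ, ENNReal.ofReal (Real.exp (-r) * r ^ n / n.factorial) * (n : ℝ≥0∞) =
      ENNReal.ofReal (Real.exp (-r) * r ^ n / n.factorial * n) := fun n => by
    rw [ENNReal.ofReal_mul (by positivity), ENNReal.ofReal_natCast]
  simp_rw [h]
  rw [← ENNReal.ofReal_tsum_of_nonneg (fun n => by positivity) hs.summable, hs.tsum_eq,
    ENNReal.ofReal_coe_nnreal]

theorem integral_exp_neg_poissonMeasure (r : ℝ≥0) (c : ℝ) :
    ∫ n : ℕ, Real.exp (-(c * n)) ∂poissonMeasure r =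
      Real.exp (-(r * (1 - Real.exp (-c)))) := by
  rw [integral_poissonMeasure]
  have h := (NormedSpace.expSeries_div_hasSum_exp ((r : ℝ) * Real.exp (-c))).mul_left
    (Real.exp (-r))
  rw [← Real.exp_eq_exp_ℝ, ← Real.exp_add] at h
  rw [show -((r : ℝ) * (1 - Real.exp (-c))) = -r + r * Real.exp (-c) by ring, ← h.tsum_eq]
  refine tsum_congr fun n => ?_
  rw [mul_pow, ← Real.exp_nat_mul, smul_eq_mul]
  ring_nf

variable {Ω X : Type*} [MeasurableSpace Ω] [MeasurableSpace X] {N : Ω → Measure X}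
  {Λ : Measure X} {P : Measure Ω}

theorem IsPoissonPP.measurable_apply (h : IsPoissonPP N Λ P) {A : Set X} (hA : MeasurableSet A) :
    Measurable fun ω => N ω A :=
  (Measure.measurable_coe hA).comp h.measurable

theorem IsPoissonPP.lintegral_apply (h : IsPoissonPP N Λ P) {A : Set X} (hA : MeasurableSet A)
    (hfin : Λ A ≠ ∞) : ∫⁻ ω, N ω A ∂P = Λ A := by
  have hl := h.poisson A hA hfin
  have h1 : ∫⁻ ω, N ω A ∂P = ∫⁻ x, x ∂(P.map fun ω => N ω A) :=
    (lintegral_map measurable_id' (h.measurable_apply hA)).symm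
  rw [h1, hl.map_eq, lintegral_map measurable_id' (by fun_prop)]
  rw [lintegral_natCast_poissonMeasure, ENNReal.coe_toNNReal hfin]

theorem IsPoissonPP.ae_lt_top (h : IsPoissonPP N Λ P) {A : Set X} (hA : MeasurableSet A)
    (hfin : Λ A ≠ ∞) : ∀ᵐ ω ∂P, N ω A < ∞ :=
  MeasureTheory.ae_lt_top (h.measurable_apply hA) (by rwa [h.lintegral_apply hA hfin])

/-- The mean measure of a Poisson process is its intensity. -/
theorem IsPoissonPP.bind_eq (h : IsPoissonPP N Λ P) [SigmaFinite Λ] : P.bind N = Λ := by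
  -- The Poisson property speaks only of sets of finite intensity, so the measures are compared on a
  -- countable cover by such sets.
  refine (Measure.ext_iff_of_iUnion_eq_univ (iUnion_spanningSets Λ)).2 fun n => ?_
  ext A hA
  have hm := hA.inter (measurableSet_spanningSets Λ n)
  rw [Measure.restrict_apply hA, Measure.restrict_apply hA,
    Measure.bind_apply hm h.measurable.aemeasurable]
  exact h.lintegral_apply hm
    ((measure_mono inter_subset_right).trans_lt (measure_spanningSets_lt_top Λ n)).ne

/-- Campbell's formula. -/
theorem IsPoissonPP.lintegral_lintegral (h : IsPoissonPP N Λ P) [SigmaFinite Λ] {f : X → ℝ≥0∞}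
    (hf : Measurable f) : ∫⁻ ω, ∫⁻ x, f x ∂N ω ∂P = ∫⁻ x, f x ∂Λ := by
  rw [← Measure.lintegral_bind h.measurable.aemeasurable hf.aemeasurable, h.bind_eq]

theorem IsPoissonPP.measurable_lintegral (h : IsPoissonPP N Λ P) {f : X → ℝ≥0∞}
    (hf : Measurable f) : Measurable fun ω => ∫⁻ x, f x ∂N ω :=
  (Measure.measurable_lintegral hf).comp h.measurable

theorem IsPoissonPP.integral_exp_neg_apply (h : IsPoissonPP N Λ P) {A : Set X}
    (hA : MeasurableSet A) (hfin : Λ A ≠ ∞) (c : ℝ) :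
    ∫ ω, Real.exp (-(c * (N ω A).toReal)) ∂P =
      Real.exp (-((Λ A).toReal * (1 - Real.exp (-c)))) := by
  have hl := h.poisson A hA hfin
  have hm : Measurable fun t : ℝ≥0∞ => Real.exp (-(c * t.toReal)) := by fun_prop
  have h1 := hl.integral_comp hm.aestronglyMeasurable
  rw [integral_map (by fun_prop) hm.aestronglyMeasurable] at h1
  simp only [Function.comp_def, ENNReal.toReal_natCast] at h1
  rw [h1, integral_exp_neg_poissonMeasure]
  rfl

/-- The Laplace functional of a Poisson process at a simple function. -/
theorem IsPoissonPP.integral_exp_neg_simpleFunc (h : IsPoissonPP N Λ P) [IsProbabilityMeasure P]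
    (φ : SimpleFunc X ℝ≥0∞) (hφ : ∀ x, φ x < ∞) (hsupp : Λ (Function.support φ) < ∞) :
    ∫ ω, Real.exp (-(∫⁻ x, φ x ∂N ω).toReal) ∂P =
      Real.exp (-(∫⁻ x, ENNReal.ofReal (1 - Real.exp (-(φ x).toReal)) ∂Λ).toReal) := by
  classical
  -- The level set of `0` may have infinite intensity, but it contributes nothing; the other level
  -- sets lie in the support, which has finite intensity.
  set s := φ.range.erase 0
  have hAm : ∀ y : s, MeasurableSet (φ ⁻¹' {(y : ℝ≥0∞)}) := fun y => φ.measurableSet_fiber _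
  have hy : ∀ y : s, (y : ℝ≥0∞) ≠ ∞ := fun y => by
    obtain ⟨x, hx⟩ := SimpleFunc.mem_range.1 (Finset.mem_of_mem_erase y.2)
    exact hx ▸ (hφ x).ne
  have hAfin : ∀ y : s, Λ (φ ⁻¹' {(y : ℝ≥0∞)}) ≠ ∞ := fun y =>
    ((measure_mono fun x hx => by
      rw [Function.mem_support, show φ x = y from hx]
      exact Finset.ne_of_mem_erase y.2).trans_lt hsupp).ne
  have hsum : ∀ (ν : Measure X) (g : ℝ≥0∞ → ℝ≥0∞), g 0 = 0 →
      ∫⁻ x, g (φ x) ∂ν = ∑ y : s, g y * ν (φ ⁻¹' {(y : ℝ≥0∞)}) := fun ν g hg => by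
    have h1 : ∫⁻ x, g (φ x) ∂ν = (φ.map g).lintegral ν := by
      rw [← SimpleFunc.lintegral_eq_lintegral]; rfl
    rw [h1, SimpleFunc.map_lintegral, Finset.sum_coe_sort s fun y => g y * ν (φ ⁻¹' {y}),
      Finset.sum_erase _ (by rw [hg, zero_mul])]
  -- Independence is assumed for families indexed by `Fin n`, hence the detour through an
  -- enumeration of `s`.
  have hind : iIndepFun (fun (y : s) ω => N ω (φ ⁻¹' {(y : ℝ≥0∞)})) P := by
    have h1 := h.indep s.card (fun i => φ ⁻¹' {((s.equivFin.symm i : s) : ℝ≥0∞)})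
      (fun i => hAm _) fun i j hij => Disjoint.preimage _ (by
        rw [disjoint_singleton]
        exact fun h => hij (s.equivFin.symm.injective (Subtype.ext h)))
    simpa using h1.precomp s.equivFin.injective
  have hL : ∀ᵐ ω ∂P, Real.exp (-(∫⁻ x, φ x ∂N ω).toReal) =
      ∏ y : s, Real.exp (-((y : ℝ≥0∞).toReal * (N ω (φ ⁻¹' {(y : ℝ≥0∞)})).toReal)) := by
    have hall : ∀ᵐ ω ∂P, ∀ y : s, N ω (φ ⁻¹' {(y : ℝ≥0∞)}) < ∞ :=
      ae_all_iff.2 fun y => h.ae_lt_top (hAm y) (hAfin y)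
    filter_upwards [hall] with ω hω
    rw [← Real.exp_sum, Finset.sum_neg_distrib, hsum (N ω) (fun t => t) rfl,
      ENNReal.toReal_sum fun y _ => ENNReal.mul_ne_top (hy y) (hω y).ne]
    simp [ENNReal.toReal_mul]
  rw [integral_congr_ae hL, hind.integral_fun_prod_comp
    (f := fun (y : s) (t : ℝ≥0∞) => Real.exp (-((y : ℝ≥0∞).toReal * t.toReal)))
    (fun y => (h.measurable_apply (hAm y)).aemeasurable)
    (fun y => Measurable.aestronglyMeasurable (by fun_prop))]
  simp_rw [fun y : s => h.integral_exp_neg_apply (hAm y) (hAfin y) (y : ℝ≥0∞).toReal]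
  rw [← Real.exp_sum, Finset.sum_neg_distrib,
    hsum Λ (fun t => ENNReal.ofReal (1 - Real.exp (-t.toReal))) (by simp),
    ENNReal.toReal_sum fun y _ => ENNReal.mul_ne_top ENNReal.ofReal_ne_top (hAfin y)]
  congr 2
  refine Finset.sum_congr rfl fun y _ => ?_
  rw [ENNReal.toReal_mul, ENNReal.toReal_ofReal (by simp), mul_comm]

theorem tendsto_exp_neg_toReal {u : ℕ → ℝ≥0∞} {a : ℝ≥0∞} (ha : a ≠ ∞)
    (hu : Tendsto u atTop (𝓝 a)) :
    Tendsto (fun n => Real.exp (-(u n).toReal)) atTop (𝓝 (Real.exp (-a.toReal))) :=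
  (Real.continuous_exp.tendsto _).comp ((ENNReal.tendsto_toReal ha).comp hu).neg

/-- The Laplace functional of a Poisson process. -/
theorem IsPoissonPP.integral_exp_neg_lintegral (h : IsPoissonPP N Λ P) [SigmaFinite Λ]
    [IsProbabilityMeasure P] {v : X → ℝ≥0∞} (hv : Measurable v) (hvt : ∀ x, v x ≠ ∞)
    (hfin : ∫⁻ x, v x ∂Λ ≠ ∞) :
    ∫ ω, Real.exp (-(∫⁻ x, v x ∂N ω).toReal) ∂P =
      Real.exp (-(∫⁻ x, ENNReal.ofReal (1 - Real.exp (-(v x).toReal)) ∂Λ).toReal) := by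
  -- These approximations are finite-valued and, since `v` is integrable, supported on sets of
  -- finite intensity. The left side converges by domination by `1`, the exponent on the right by
  -- monotonicity.
  set φ := SimpleFunc.eapprox v
  have hmono : ∀ x, Monotone fun n => φ n x := fun x m n hmn => SimpleFunc.monotone_eapprox v hmn x
  have hlim : ∀ x, Tendsto (fun n => φ n x) atTop (𝓝 (v x)) := SimpleFunc.tendsto_eapprox hv
  have hlt : ∀ n x, φ n x < ∞ := SimpleFunc.eapprox_lt_top v
  have hsimple := fun n => h.integral_exp_neg_simpleFunc (φ n) (hlt n)
    (measure_support_eapprox_lt_top hv hfin n)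
  have hae : ∀ᵐ ω ∂P, ∫⁻ x, v x ∂N ω < ∞ :=
    MeasureTheory.ae_lt_top (h.measurable_lintegral hv) (by rwa [h.lintegral_lintegral hv])
  have hL : Tendsto (fun n => ∫ ω, Real.exp (-(∫⁻ x, φ n x ∂N ω).toReal) ∂P) atTop
      (𝓝 (∫ ω, Real.exp (-(∫⁻ x, v x ∂N ω).toReal) ∂P)) := by
    refine tendsto_integral_of_dominated_convergence (fun _ => 1) (fun n => ?_)
      (integrable_const _) (fun n => ae_of_all _ fun ω => ?_) ?_
    · exact ((h.measurable_lintegral (φ n).measurable).ennreal_toReal.neg.exp).aestronglyMeasurable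
    · rw [Real.norm_eq_abs, Real.abs_exp]
      exact Real.exp_le_one_iff.2 (neg_nonpos.2 ENNReal.toReal_nonneg)
    · filter_upwards [hae] with ω hω
      exact tendsto_exp_neg_toReal hω.ne (lintegral_tendsto_of_tendsto_of_monotone
        (fun n => (φ n).measurable.aemeasurable) (ae_of_all _ hmono) (ae_of_all _ hlim))
  refine tendsto_nhds_unique hL ?_
  simp_rw [hsimple]
  refine tendsto_exp_neg_toReal ?_ (lintegral_tendsto_of_tendsto_of_monotone
    (fun n => ?_) (ae_of_all _ fun x m n hmn => ?_) (ae_of_all _ fun x => ?_))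
  · refine ((lintegral_mono fun x => ?_).trans_lt hfin.lt_top).ne
    refine ENNReal.ofReal_le_of_le_toReal ?_
    linarith [Real.add_one_le_exp (-(v x).toReal)]
  · exact ((φ n).measurable.ennreal_toReal.neg.exp.const_sub 1).ennreal_ofReal.aemeasurable
  · refine ENNReal.ofReal_le_ofReal (sub_le_sub_left (Real.exp_le_exp.2 (neg_le_neg ?_)) _)
    exact ENNReal.toReal_mono (hlt n x).ne (hmono x hmn)
  · exact ENNReal.tendsto_ofReal (tendsto_const_nhds.sub (tendsto_exp_neg_toReal (hvt x) (hlim x)))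

end Poisson

/-! ### Independently marked Poisson processes -/

section Marked

open Filter Topology

/-- Integration of a bounded function of two independent variables. -/
theorem integral_comp_prodMk_of_indepFun {Ω E F : Type*} [MeasurableSpace Ω] [MeasurableSpace E]
    [MeasurableSpace F] {P : Measure Ω} [IsProbabilityMeasure P] {X : Ω → E} {Y : Ω → F}
    (h : IndepFun X Y P) (hX : Measurable X) (hY : Measurable Y) {g : E × F → ℝ}
    (hg : Measurable g) {C : ℝ} (hC : ∀ q, |g q| ≤ C) :
    ∫ ω, g (X ω, Y ω) ∂P = ∫ ω, ∫ ω', g (X ω, Y ω') ∂P ∂P := by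
  have hPX : IsProbabilityMeasure (P.map X) := Measure.isProbabilityMeasure_map hX.aemeasurable
  have hPY : IsProbabilityMeasure (P.map Y) := Measure.isProbabilityMeasure_map hY.aemeasurable
  rw [← integral_map (φ := fun ω => (X ω, Y ω)) (hX.prodMk hY).aemeasurable
    hg.aestronglyMeasurable, h.map_prod_eq_prod_map_map hX.aemeasurable hY.aemeasurable,
    integral_prod _ (Integrable.of_bound hg.aestronglyMeasurable C (ae_of_all _ hC)),
    integral_map hX.aemeasurable
      (hg.stronglyMeasurable.integral_prod_right' (ν := P.map Y)).aestronglyMeasurable]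
  refine integral_congr_ae (ae_of_all _ fun ω => ?_)
  exact integral_map hY.aemeasurable (hg.comp measurable_prodMk_left).aestronglyMeasurable

variable {Ω X : Type*} [MeasurableSpace Ω] [MeasurableSpace X]

/-- The value of `f` at the `i`-th point of a sequence of points with a given length. -/
def pointValue (f : X → ℝ≥0∞) (a : ℕ∞ × (ℕ → X)) (i : ℕ) : ℝ≥0∞ :=
  open Classical in if (i : ℕ∞) < a.1 then f (a.2 i) else 0

theorem measurableSet_lt_fst (i : ℕ) : MeasurableSet {a : ℕ∞ × (ℕ → X) | (i : ℕ∞) < a.1} :=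
  measurable_fst (MeasurableSet.of_discrete (s := {n : ℕ∞ | (i : ℕ∞) < n}))

theorem measurable_pointValue {f : X → ℝ≥0∞} (hf : Measurable f) (i : ℕ) :
    Measurable fun a : ℕ∞ × (ℕ → X) => pointValue f a i :=
  Measurable.ite (measurableSet_lt_fst i)
    (hf.comp ((measurable_pi_apply i).comp measurable_snd)) measurable_const

/-- The counting measure of a sequence of points with a given length. -/
def countingMeasure (a : ℕ∞ × (ℕ → X)) : Measure X :=
  open Classical in
  Measure.sum fun i : ℕ => if (i : ℕ∞) < a.1 then Measure.dirac (a.2 i) else 0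

theorem lintegral_countingMeasure {f : X → ℝ≥0∞} (hf : Measurable f) (a : ℕ∞ × (ℕ → X)) :
    ∫⁻ x, f x ∂countingMeasure a = ∑' i, pointValue f a i := by
  rw [countingMeasure, lintegral_sum_measure]
  refine tsum_congr fun i => ?_
  unfold pointValue
  split_ifs
  · exact lintegral_dirac' _ hf
  · exact lintegral_zero_measure _

/-- A Poisson process with intensity `Λ`, given by an enumeration of its points, with independent
nonnegative marks of law `μ`. -/
structure IsMarkedPoisson (pts : Ω → ℕ∞ × (ℕ → X)) (mark : ℕ → Ω → ℝ) (Λ : Measure X)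
    (μ : Measure ℝ) (P : Measure Ω) : Prop where
  measurable_pts : Measurable pts
  measurable_mark : ∀ i, Measurable (mark i)
  poisson : IsPoissonPP (fun ω => countingMeasure (pts ω)) Λ P
  law_mark : ∀ i, HasLaw (mark i) μ P
  indep_mark : iIndepFun mark P
  indep : IndepFun pts (fun ω i => mark i ω) P

/-- The sum of `f` over a sequence of points, weighted by marks. -/
def shotNoise (f : X → ℝ≥0∞) (a : ℕ∞ × (ℕ → X)) (m : ℕ → ℝ) : ℝ≥0∞ :=
  ∑' i, ENNReal.ofReal (m i) * pointValue f a i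

variable {pts : Ω → ℕ∞ × (ℕ → X)} {mark : ℕ → Ω → ℝ} {Λ : Measure X} {μ : Measure ℝ}
  {P : Measure Ω}

/-- Each mark is independent of the points, so every term splits into the mean mark times a point
term, and Campbell's formula resums the latter. -/
theorem IsMarkedPoisson.lintegral_shotNoise (h : IsMarkedPoisson pts mark Λ μ P) [SigmaFinite Λ]
    {f : X → ℝ≥0∞} (hf : Measurable f) :
    ∫⁻ ω, shotNoise f (pts ω) (fun i => mark i ω) ∂P =
      (∫⁻ x, ENNReal.ofReal x ∂μ) * ∫⁻ x, f x ∂Λ := by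
  have hpm : ∀ i, Measurable fun ω => pointValue f (pts ω) i := fun i =>
    (measurable_pointValue hf i).comp h.measurable_pts
  have hterm : ∀ i, ∫⁻ ω, ENNReal.ofReal (mark i ω) * pointValue f (pts ω) i ∂P =
      (∫⁻ x, ENNReal.ofReal x ∂μ) * ∫⁻ ω, pointValue f (pts ω) i ∂P := fun i => by
    rw [lintegral_mul_eq_lintegral_mul_lintegral_of_indepFun''
      (h.measurable_mark i).ennreal_ofReal.aemeasurable (hpm i).aemeasurable
      (h.indep.symm.comp (φ := fun m : ℕ → ℝ => ENNReal.ofReal (m i)) (by fun_prop)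
        (measurable_pointValue hf i)),
      ← (h.law_mark i).map_eq, lintegral_map (by fun_prop) (h.measurable_mark i)]
  have hmm : ∀ i, Measurable fun ω => ENNReal.ofReal (mark i ω) * pointValue f (pts ω) i :=
    fun i => (h.measurable_mark i).ennreal_ofReal.mul (hpm i)
  unfold shotNoise
  rw [lintegral_tsum fun i => (hmm i).aemeasurable]
  simp_rw [hterm]
  rw [ENNReal.tsum_mul_left, ← lintegral_tsum fun i => (hpm i).aemeasurable,
    ← h.poisson.lintegral_lintegral hf]
  simp_rw [lintegral_countingMeasure hf]

theorem measurable_shotNoise {f : X → ℝ≥0∞} (hf : Measurable f) :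
    Measurable fun q : (ℕ∞ × (ℕ → X)) × (ℕ → ℝ) => shotNoise f q.1 q.2 :=
  Measurable.tsum fun i => (ENNReal.measurable_ofReal.comp
    ((measurable_pi_apply i).comp measurable_snd)).mul
      ((measurable_pointValue hf i).comp measurable_fst)

theorem IsMarkedPoisson.measurable_shotNoise (h : IsMarkedPoisson pts mark Λ μ P)
    {f : X → ℝ≥0∞} (hf : Measurable f) :
    Measurable fun ω => shotNoise f (pts ω) (fun i => mark i ω) :=
  (CoopSensing.measurable_shotNoise hf).comp
    (h.measurable_pts.prodMk (measurable_pi_lambda _ h.measurable_mark))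

theorem IsMarkedPoisson.ae_shotNoise_lt_top (h : IsMarkedPoisson pts mark Λ μ P) [SigmaFinite Λ]
    {f : X → ℝ≥0∞} (hf : Measurable f) (hμ : ∫⁻ x, ENNReal.ofReal x ∂μ ≠ ∞)
    (hfin : ∫⁻ x, f x ∂Λ ≠ ∞) : ∀ᵐ ω ∂P, shotNoise f (pts ω) (fun i => mark i ω) < ∞ :=
  ae_lt_top (h.measurable_shotNoise hf)
    (by rw [h.lintegral_shotNoise hf]; exact ENNReal.mul_ne_top hμ hfin)

theorem exp_neg_toReal_sum {ι : Type*} (s : Finset ι) {u : ι → ℝ≥0∞} (hu : ∀ i, u i ≠ ∞) :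
    Real.exp (-(∑ i ∈ s, u i).toReal) = ∏ i ∈ s, Real.exp (-(u i).toReal) := by
  rw [ENNReal.toReal_sum fun i _ => hu i, ← Finset.sum_neg_distrib, Real.exp_sum]

theorem pointValue_ne_top {X : Type*} {f : X → ℝ≥0∞} (hf : ∀ x, f x ≠ ∞) (a : ℕ∞ × (ℕ → X)) (i : ℕ) :
    pointValue f a i ≠ ∞ := by
  unfold pointValue
  split_ifs
  · exact hf _
  · exact ENNReal.zero_ne_top

/-- Averaging finitely many terms of a shot noise over the marks. -/
theorem IsMarkedPoisson.integral_exp_neg_sum (h : IsMarkedPoisson pts mark Λ μ P)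
    [IsProbabilityMeasure P] {f : X → ℝ≥0∞} (hf : Measurable f) (hft : ∀ x, f x ≠ ∞)
    (hμ0 : ∀ᵐ x ∂μ, 0 ≤ x) {ψ : ℝ → ℝ}
    (hψ : ∀ t, 0 ≤ t → ∫ x, Real.exp (-(t * x)) ∂μ = ψ t) (n : ℕ) :
    ∫ ω, Real.exp (-(∑ i ∈ Finset.range n,
        ENNReal.ofReal (mark i ω) * pointValue f (pts ω) i).toReal) ∂P =
      ∫ ω, ∏ i ∈ Finset.range n, ψ (pointValue f (pts ω) i).toReal ∂P := by
  have hm : Measurable fun q : (ℕ∞ × (ℕ → X)) × (ℕ → ℝ) => Real.exp (-(∑ i ∈ Finset.range n,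
      ENNReal.ofReal (q.2 i) * pointValue f q.1 i).toReal) := by
    refine (Measurable.ennreal_toReal ?_).neg.exp
    refine Finset.measurable_fun_sum _ fun i _ => ?_
    exact (ENNReal.measurable_ofReal.comp ((measurable_pi_apply i).comp measurable_snd)).mul
      ((measurable_pointValue hf i).comp measurable_fst)
  -- Fubini: for frozen points the summands depend on distinct marks and are independent, so the
  -- inner integral is a product of values of `ψ`.
  have h1 := integral_comp_prodMk_of_indepFun h.indep h.measurable_pts
    (measurable_pi_lambda _ h.measurable_mark) hm (C := 1) fun q => by
      rw [Real.abs_exp]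
      exact Real.exp_le_one_iff.2 (neg_nonpos.2 ENNReal.toReal_nonneg)
  rw [h1]
  refine integral_congr_ae (ae_of_all _ fun ω => ?_)
  have hind : iIndepFun (fun (i : Fin n) => mark i) P := h.indep_mark.precomp Fin.val_injective
  have h2 := hind.integral_fun_prod_comp (f := fun (i : Fin n) (x : ℝ) =>
      Real.exp (-(ENNReal.ofReal x * pointValue f (pts ω) i).toReal))
    (fun i => (h.measurable_mark i).aemeasurable)
    (fun i => Measurable.aestronglyMeasurable (by fun_prop))
  have h3 : ∀ i : ℕ, ∫ ω', Real.exp (-(ENNReal.ofReal (mark i ω') *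
      pointValue f (pts ω) i).toReal) ∂P = ψ (pointValue f (pts ω) i).toReal := fun i => by
    rw [← hψ _ ENNReal.toReal_nonneg]
    have h4 := (h.law_mark i).integral_comp (f := fun x : ℝ =>
      Real.exp (-(ENNReal.ofReal x * pointValue f (pts ω) i).toReal))
      (Measurable.aestronglyMeasurable (by fun_prop))
    simp only [Function.comp_def] at h4
    rw [h4]
    refine integral_congr_ae ?_
    filter_upwards [hμ0] with x hx
    rw [ENNReal.toReal_mul, ENNReal.toReal_ofReal hx, mul_comm]
  simp only [exp_neg_toReal_sum _ fun i =>
    ENNReal.mul_ne_top ENNReal.ofReal_ne_top (pointValue_ne_top hft (pts ω) i)]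
  simp_rw [h3] at h2
  simp_rw [Finset.prod_range]
  exact h2

/-- The Laplace functional of an independently marked Poisson process. -/
theorem IsMarkedPoisson.integral_exp_neg_shotNoise (h : IsMarkedPoisson pts mark Λ μ P)
    [SigmaFinite Λ] [IsProbabilityMeasure P] {f : X → ℝ≥0∞} (hf : Measurable f)
    (hft : ∀ x, f x ≠ ∞) (hfin : ∫⁻ x, f x ∂Λ ≠ ∞)
    (hμ0 : ∀ᵐ x ∂μ, 0 ≤ x) (hμ : ∫⁻ x, ENNReal.ofReal x ∂μ ≠ ∞) {ψ : ℝ → ℝ} (hψm : Measurable ψ)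
    (hψ : ∀ t, 0 ≤ t → ∫ x, Real.exp (-(t * x)) ∂μ = ψ t) (hψ1 : ∀ t, 0 ≤ t → ψ t ≤ 1) {C : ℝ}
    (hC : 0 ≤ C) (hψC : ∀ t, 0 ≤ t → Real.exp (-(C * t)) ≤ ψ t) :
    ∫ ω, Real.exp (-(shotNoise f (pts ω) fun i => mark i ω).toReal) ∂P =
      Real.exp (-(∫⁻ x, ENNReal.ofReal (1 - ψ (f x).toReal) ∂Λ).toReal) := by
  have hψ0 : ∀ t, 0 ≤ t → 0 < ψ t := fun t ht => (Real.exp_pos _).trans_le (hψC t ht)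
  have hψz : ψ 0 = 1 := le_antisymm (hψ1 0 le_rfl) (by simpa using hψC 0 le_rfl)
  -- The weight with `exp (-w) = ψ (f)`: the marked process at `f` behaves like the unmarked process
  -- at `w`. The lower bound on `ψ` yields `w ≤ C * f`, hence integrability.
  set w : X → ℝ≥0∞ := fun x => ENNReal.ofReal (-Real.log (ψ (f x).toReal)) with hw
  have hwm : Measurable w :=
    (Real.measurable_log.comp (hψm.comp hf.ennreal_toReal)).neg.ennreal_ofReal
  have hwt : ∀ x, w x ≠ ∞ := fun x => ENNReal.ofReal_ne_top
  have hexpw : ∀ x, Real.exp (-(w x).toReal) = ψ (f x).toReal := fun x => by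
    have hp := hψ0 _ (ENNReal.toReal_nonneg (a := f x))
    rw [hw, ENNReal.toReal_ofReal, neg_neg, Real.exp_log hp]
    exact neg_nonneg.2 (Real.log_nonpos hp.le (hψ1 _ ENNReal.toReal_nonneg))
  have hwfin : ∫⁻ x, w x ∂Λ ≠ ∞ := by
    have hle : ∀ x, w x ≤ ENNReal.ofReal C * f x := fun x => by
      have hp := hψC _ (ENNReal.toReal_nonneg (a := f x))
      rw [← ENNReal.ofReal_toReal (hft x), ← ENNReal.ofReal_mul hC]
      refine ENNReal.ofReal_le_ofReal ?_
      have := Real.log_le_log (Real.exp_pos _) hp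
      rw [Real.log_exp] at this
      linarith
    refine ((lintegral_mono hle).trans_lt ?_).ne
    rw [lintegral_const_mul _ hf]
    exact (ENNReal.mul_ne_top ENNReal.ofReal_ne_top hfin).lt_top
  -- For an index beyond the count both sides are `1`, thanks to `ψ 0 = 1`.
  have hcut : ∀ a i, ψ (pointValue f a i).toReal = Real.exp (-(pointValue w a i).toReal) := by
    intro a i
    unfold pointValue
    split_ifs
    · exact (hexpw _).symm
    · simpa using hψz
  have hlap := h.poisson.integral_exp_neg_lintegral hwm hwt hwfin
  simp_rw [hexpw, lintegral_countingMeasure hwm] at hlap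
  rw [← hlap]
  have hYlt := h.ae_shotNoise_lt_top hf hμ hfin
  have hWlt : ∀ᵐ ω ∂P, ∑' i, pointValue w (pts ω) i < ∞ := by
    have := ae_lt_top (h.poisson.measurable_lintegral hwm)
      (by rwa [h.poisson.lintegral_lintegral hwm])
    simpa only [lintegral_countingMeasure hwm] using this
  have hlim : ∀ (u : ℕ → Ω → ℝ≥0∞), (∀ i, Measurable (u i)) → (∀ᵐ ω ∂P, ∑' i, u i ω < ∞) →
      Tendsto (fun n => ∫ ω, Real.exp (-(∑ i ∈ Finset.range n, u i ω).toReal) ∂P) atTop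
        (𝓝 (∫ ω, Real.exp (-(∑' i, u i ω).toReal) ∂P)) := by
    intro u hu hlt
    refine tendsto_integral_of_dominated_convergence (fun _ => 1) (fun n => ?_)
      (integrable_const _) (fun n => ae_of_all _ fun ω => ?_) ?_
    · exact (Finset.measurable_fun_sum _ fun i _ =>
        hu i).ennreal_toReal.neg.exp.aestronglyMeasurable
    · rw [Real.norm_eq_abs, Real.abs_exp]
      exact Real.exp_le_one_iff.2 (neg_nonpos.2 ENNReal.toReal_nonneg)
    · filter_upwards [hlt] with ω hω
      exact tendsto_exp_neg_toReal hω.ne ENNReal.summable.hasSum.tendsto_sum_nat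
  have hpm : ∀ {v : X → ℝ≥0∞}, Measurable v → ∀ i, Measurable fun ω => pointValue v (pts ω) i :=
    fun hv i => (measurable_pointValue hv i).comp h.measurable_pts
  have hLY := hlim _ (fun i => (h.measurable_mark i).ennreal_ofReal.mul (hpm hf i)) hYlt
  have hLW := hlim _ (hpm hwm) hWlt
  -- The marked and unmarked averages agree for the first `n` indices, where only finitely many
  -- marks occur; hence their limits agree.
  refine tendsto_nhds_unique hLY (hLW.congr fun n => ?_)
  have := h.integral_exp_neg_sum hf hft hμ0 hψ n
  simp_rw [hcut] at this
  simp_rw [exp_neg_toReal_sum (Finset.range n) fun i => pointValue_ne_top hwt (pts _) i]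
  exact this.symm

end Marked

/-! ### Polar coordinates -/

section Polar

theorem integral_norm_plane (g : ℝ → ℝ) :
    ∫ x : Plane, g ‖x‖ = 2 * Real.pi * ∫ r in Ioi 0, g r * r := by
  have h := integral_fun_norm_addHaar (volume : Measure Plane) g
  rw [h]
  simp [measureReal_def, EuclideanSpace.volume_ball_fin_two, Real.pi_pos.le, mul_comm]
  ring

theorem integrable_norm_plane {g : ℝ → ℝ} (hg : IntegrableOn (fun r => g r * r) (Ioi 0)) :
    Integrable fun x : Plane => g ‖x‖ := by
  rw [integrable_fun_norm_addHaar]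
  simpa [mul_comm] using hg

end Polar

/-! ### Independence of the sources of randomness -/

namespace Network

variable {K : ℕ} {Ω : Type*} {M : Network K Ω}

/-- The points of a process of interferers, as a sequence with its length. -/
def pts (M : Network K Ω) (j : Kind) (ω : Ω) : ℕ∞ × (ℕ → Plane) :=
  (M.count j ω, fun i => M.pos j i ω)

/-- The marks of a process of interferers. -/
def marks (M : Network K Ω) (j : Kind) (ω : Ω) (i : ℕ) : ℝ := M.mark j i ω

/-- The σ-algebra generated by a set of sources of randomness. -/
@[reducible]
def gen (M : Network K Ω) (S : Set (Source K)) : MeasurableSpace Ω := ⨆ i ∈ S, M.sigma i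

theorem sigma_le_gen {S : Set (Source K)} {i : Source K} (hi : i ∈ S) : M.sigma i ≤ M.gen S :=
  le_biSup M.sigma hi

theorem measurable_gen_of_comap {S : Set (Source K)} {i : Source K} (hi : i ∈ S) {E : Type*}
    {mE : MeasurableSpace E} {f : Ω → E} (hf : mE.comap f ≤ M.sigma i) : Measurable[M.gen S] f :=
  measurable_iff_comap_le.2 (hf.trans (sigma_le_gen hi))

theorem measurable_gen_rcsMono {S : Set (Source K)} (h : .mono ∈ S) :
    Measurable[M.gen S] M.rcsMono := measurable_gen_of_comap h le_rfl

theorem measurable_gen_rcsBi {S : Set (Source K)} {n : Fin K} (h : .bi n ∈ S) :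
    Measurable[M.gen S] (M.rcsBi n) := measurable_gen_of_comap h le_rfl

theorem measurableSet_gen_lit {S : Set (Source K)} {n : Fin K} (h : .lit n ∈ S) :
    MeasurableSet[M.gen S] (M.lit n) :=
  sigma_le_gen h _ (MeasurableSpace.measurableSet_generateFrom rfl)

theorem measurable_gen_radT {S : Set (Source K)} (h : .radT ∈ S) :
    Measurable[M.gen S] M.radT := measurable_gen_of_comap h le_rfl

theorem measurable_gen_radI {S : Set (Source K)} (h : .radI ∈ S) :
    Measurable[M.gen S] M.radI := measurable_gen_of_comap h le_rfl

theorem measurable_gen_pts {S : Set (Source K)} {j : Kind} (h : .points j ∈ S) :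
    Measurable[M.gen S] (M.pts j) := measurable_gen_of_comap h le_rfl

theorem measurable_gen_marks {S : Set (Source K)} {j : Kind} (h : ∀ i, .mark j i ∈ S) :
    Measurable[M.gen S] (M.marks j) :=
  @measurable_pi_lambda _ _ _ (M.gen S) _ _ fun i => measurable_gen_of_comap (h i) le_rfl

/-- The points and the marks of a process of interferers. -/
def data (M : Network K Ω) (j : Kind) (ω : Ω) : (ℕ∞ × (ℕ → Plane)) × (ℕ → ℝ) :=
  (M.pts j ω, M.marks j ω)

/-- The sources of randomness of a process of interferers. -/
def dataSources (K : ℕ) (j : Kind) : Set (Source K) :=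
  {i | i = .points j ∨ ∃ n, i = .mark j n}

theorem measurable_gen_data {S : Set (Source K)} {j : Kind} (h : dataSources K j ⊆ S) :
    Measurable[M.gen S] (M.data j) :=
  Measurable.prodMk (m := M.gen S) (measurable_gen_pts (h (Or.inl rfl)))
    (measurable_gen_marks fun i => h (Or.inr ⟨i, rfl⟩))

variable [MeasurableSpace Ω] {p : Params} {R : Fin (K + 1) → ℝ} {P : Measure Ω}

theorem IsModel.measurable_pts (hM : M.IsModel p R P) (j : Kind) : Measurable (M.pts j) :=
  (hM.measurable_count j).prodMk (measurable_pi_lambda _ fun i => hM.measurable_pos j i)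

theorem IsModel.measurable_marks (hM : M.IsModel p R P) (j : Kind) : Measurable (M.marks j) :=
  measurable_pi_lambda _ fun i => hM.measurable_mark j i

theorem IsModel.sigma_le (hM : M.IsModel p R P) (i : Source K) : M.sigma i ≤ ‹_› := by
  cases i with
  | mono => exact hM.measurable_rcsMono.comap_le
  | bi n => exact (hM.measurable_rcsBi n).comap_le
  | lit n =>
    exact MeasurableSpace.generateFrom_le fun s hs => by
      rw [mem_singleton_iff.1 hs]; exact hM.measurable_lit n
  | radT => exact hM.measurable_radT.comap_le
  | radI => exact hM.measurable_radI.comap_le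
  | points j => exact (hM.measurable_pts j).comap_le
  | mark j i => exact (hM.measurable_mark j i).comap_le

theorem IsModel.gen_le (hM : M.IsModel p R P) (S : Set (Source K)) : M.gen S ≤ ‹_› :=
  iSup₂_le fun i _ => hM.sigma_le i

/-- Reduces the independence of composite quantities to the disjointness of their sets of labels. -/
theorem IsModel.indepFun (hM : M.IsModel p R P) {S T : Set (Source K)} (hST : Disjoint S T)
    {E F : Type*} {mE : MeasurableSpace E} {mF : MeasurableSpace F} {f : Ω → E} {g : Ω → F}
    (hf : Measurable[M.gen S] f) (hg : Measurable[M.gen T] g) : IndepFun f g P :=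
  (IndepFun_iff_Indep f g P).2 (indep_of_indep_of_le_left (indep_of_indep_of_le_right
    (indep_iSup_of_disjoint hM.sigma_le hM.indep hST) hg.comap_le) hf.comap_le)

theorem IsModel.measurable_data (hM : M.IsModel p R P) (j : Kind) : Measurable (M.data j) :=
  (hM.measurable_pts j).prodMk (hM.measurable_marks j)

theorem IsModel.isMarkedPoisson (hM : M.IsModel p R P) (j : Kind) :
    IsMarkedPoisson (M.pts j) (M.mark j) (p.intensity j) (p.markLaw j) P where
  measurable_pts := hM.measurable_pts j
  measurable_mark := hM.measurable_mark j
  -- `pointMeasure` is by definition the `countingMeasure` of `pts`.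
  poisson := hM.poisson j
  law_mark := hM.law_mark j
  indep_mark := by
    have h := hM.indep.precomp (g := fun i : ℕ => Source.mark j i)
      (fun a b hab => by simpa using hab)
    exact (iIndepFun_iff_iIndep _ _ _).2 h
  indep := hM.indepFun (S := {.points j}) (T := {i | ∃ n, i = .mark j n})
    (disjoint_singleton_left.2 (by simp)) (measurable_gen_pts rfl)
    (measurable_gen_marks fun i => ⟨i, rfl⟩)

end Network

/-! ### Parameters of the processes of interferers -/

namespace Params

variable {p : Params}

/-- Shape of the law of the marks. -/
def markShape (p : Params) : Kind → ℝ
  | .target => 1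
  | .los => p.mL
  | .nlos => p.mN

/-- Rate of the law of the marks. -/
def markRate (p : Params) : Kind → ℝ
  | .target => 1 / p.rcsBi
  | .los => p.mL
  | .nlos => p.mN

/-- Radial density of the intensity. -/
def radialDensity (p : Params) (j : Kind) (r : ℝ) : ℝ :=
  match j with
  | .target => p.lamBS * p.pLOS r * (p.Nb * p.thetaB / (2 * Real.pi))
  | .los => p.pLOS r * p.lamI
  | .nlos => (1 - p.pLOS r) * p.lamI

theorem markLaw_eq (p : Params) (j : Kind) :
    p.markLaw j = gammaMeasure (p.markShape j) (p.markRate j) := by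
  cases j <;> rfl

theorem intensity_eq (p : Params) (j : Kind) :
    p.intensity j = volume.withDensity fun x => ENNReal.ofReal (p.radialDensity j ‖x‖) := by
  cases j <;> rfl

theorem Valid.markShape_pos (hp : p.Valid) (j : Kind) : 0 < p.markShape j := by
  cases j
  exacts [one_pos, hp.mL_pos, hp.mN_pos]

theorem Valid.markRate_pos (hp : p.Valid) (j : Kind) : 0 < p.markRate j := by
  cases j
  exacts [one_div_pos.2 hp.rcsBi_pos, hp.mL_pos, hp.mN_pos]

theorem Valid.lamI_nonneg (hp : p.Valid) : 0 ≤ p.lamI := by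
  have := hp.lamBS_pos
  have := hp.thetaB_pos
  unfold lamI
  positivity

theorem pLOS_pos (p : Params) (r : ℝ) : 0 < p.pLOS r := Real.exp_pos _

theorem Valid.pLOS_le_one (hp : p.Valid) {r : ℝ} (hr : 0 ≤ r) : p.pLOS r ≤ 1 :=
  Real.exp_le_one_iff.2 (neg_nonpos.2 (mul_nonneg hp.etaB_pos.le hr))

theorem Valid.radialDensity_nonneg (hp : p.Valid) (j : Kind) {r : ℝ} (hr : 0 ≤ r) :
    0 ≤ p.radialDensity j r := by
  have h1 := hp.lamBS_pos
  have h2 := hp.thetaB_pos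
  have h3 := p.pLOS_pos r
  cases j
  · simp only [radialDensity]; positivity
  · exact mul_nonneg h3.le hp.lamI_nonneg
  · exact mul_nonneg (sub_nonneg.2 (hp.pLOS_le_one hr)) hp.lamI_nonneg

theorem measurable_radialDensity (p : Params) (j : Kind) : Measurable (p.radialDensity j) := by
  unfold radialDensity pLOS
  cases j <;> fun_prop

theorem sigmaFinite_intensity (p : Params) (j : Kind) : SigmaFinite (p.intensity j) := by
  rw [intensity_eq]
  exact SigmaFinite.withDensity_ofReal _

/-- The LoS densities decay exponentially, so any positive exponent will do. The NLoS density is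
only bounded, so the tail `r ^ (1 - p.aN)` forces `2 < p.aN`. Staying beyond `d > 0` avoids the
singularity of the path loss at the origin. -/
theorem Valid.integrableOn_radialDensity (hp : p.Valid) (j : Kind) {d : ℝ} (hd : 0 < d) :
    IntegrableOn (fun r => p.radialDensity j r * r ^ (-p.exponent j) * r) (Ioi d) := by
  have hsub : Ioi d ⊆ Ioi 0 := Ioi_subset_Ioi hd.le
  have hmeas : ∀ j, AEStronglyMeasurable
      (fun r => p.radialDensity j r * r ^ (-p.exponent j) * r) (volume.restrict (Ioi d)) := by
    intro j
    have := p.measurable_radialDensity j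
    exact Measurable.aestronglyMeasurable (by fun_prop)
  have hexp : ∀ c : ℝ, IntegrableOn
      (fun r => c * d ^ (-p.aL) * (r ^ ((2 : ℝ) - 1) * Real.exp (-(p.etaB * r)))) (Ioi d) :=
    fun c => ((integrableOn_rpow_mul_exp_neg_mul two_pos hp.etaB_pos).mono_set hsub).const_mul _
  have hbound : ∀ c : ℝ, 0 ≤ c → ∀ r ∈ Ioi d,
      ‖c * p.pLOS r * r ^ (-p.aL) * r‖ ≤
        c * d ^ (-p.aL) * (r ^ ((2 : ℝ) - 1) * Real.exp (-(p.etaB * r))) := by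
    intro c hc r hr
    have hr0 : 0 < r := hsub hr
    have h1 : r ^ (-p.aL) ≤ d ^ (-p.aL) :=
      Real.rpow_le_rpow_of_nonpos hd (le_of_lt hr) (neg_nonpos.2 hp.aL_pos.le)
    have h2 := p.pLOS_pos r
    rw [Real.norm_of_nonneg (by positivity), show (2 : ℝ) - 1 = 1 by norm_num, Real.rpow_one]
    calc _ = c * r * p.pLOS r * r ^ (-p.aL) := by ring
      _ ≤ c * r * p.pLOS r * d ^ (-p.aL) := by gcongr
      _ = _ := by rw [pLOS]; ring
  have h1 := hp.lamBS_pos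
  have h2 := hp.thetaB_pos
  cases j
  · refine (hexp (p.lamBS * (p.Nb * p.thetaB / (2 * Real.pi)))).mono' (hmeas _) ?_
    filter_upwards [ae_restrict_mem measurableSet_Ioi] with r hr
    refine (congrArg norm ?_).trans_le
      (hbound (p.lamBS * (p.Nb * p.thetaB / (2 * Real.pi))) (by positivity) r hr)
    simp only [radialDensity, exponent]
    ring
  · refine (hexp p.lamI).mono' (hmeas _) ?_
    filter_upwards [ae_restrict_mem measurableSet_Ioi] with r hr
    refine (congrArg norm ?_).trans_le (hbound p.lamI hp.lamI_nonneg r hr)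
    simp only [radialDensity, exponent]
    ring
  · have hint : IntegrableOn (fun r => p.lamI * r ^ (-p.aN + 1)) (Ioi d) :=
      (integrableOn_Ioi_rpow_of_lt (by linarith [hp.two_lt_aN]) hd).const_mul _
    refine hint.mono' (hmeas _) ?_
    filter_upwards [ae_restrict_mem measurableSet_Ioi] with r hr
    have hr0 : 0 < r := hsub hr
    have h3 := p.pLOS_pos r
    have h4 := hp.pLOS_le_one hr0.le
    have h5 := hp.lamI_nonneg
    rw [Real.norm_of_nonneg (mul_nonneg (mul_nonneg (hp.radialDensity_nonneg _ hr0.le)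
      (by positivity)) hr0.le), Real.rpow_add_one hr0.ne']
    simp only [radialDensity, exponent]
    calc _ ≤ 1 * p.lamI * r ^ (-p.aN) * r := by gcongr; linarith
      _ = _ := by ring

end Params

/-! ### Interference at a fixed exclusion radius -/

section Radial

/-- The path loss at the points outside an exclusion disk. -/
def pathLoss (α d : ℝ) (x : Plane) : ℝ≥0∞ :=
  if d ≤ ‖x‖ then ENNReal.ofReal (‖x‖ ^ (-α)) else 0

theorem pathLoss_ne_top (α d : ℝ) (x : Plane) : pathLoss α d x ≠ ∞ := by
  unfold pathLoss
  split_ifs <;> simp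

theorem measurable_pathLoss_uncurry (α : ℝ) :
    Measurable fun q : ℝ × Plane => pathLoss α q.1 q.2 :=
  Measurable.ite (measurableSet_le measurable_fst measurable_snd.norm)
    (by fun_prop) measurable_const

theorem measurable_pathLoss (α d : ℝ) : Measurable (pathLoss α d) :=
  (measurable_pathLoss_uncurry α).comp measurable_prodMk_left

/-- The exclusion radius is random, so measurability is needed jointly in the radius, the points and
the marks. -/
theorem measurable_shotNoise_pathLoss (α : ℝ) :
    Measurable fun q : ℝ × ((ℕ∞ × (ℕ → Plane)) × (ℕ → ℝ)) =>
      shotNoise (pathLoss α q.1) q.2.1 q.2.2 := by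
  refine Measurable.tsum fun i => Measurable.mul (by fun_prop) ?_
  refine Measurable.ite (?_ : MeasurableSet _) ?_ measurable_const
  · exact (measurable_fst.comp measurable_snd) (measurableSet_lt_fst i)
  · exact (measurable_pathLoss_uncurry α).comp (measurable_fst.prodMk (by fun_prop))

theorem shotNoise_const_mul {X : Type*} (c : ℝ≥0∞) (f : X → ℝ≥0∞) (a : ℕ∞ × (ℕ → X))
    (m : ℕ → ℝ) : shotNoise (fun x => c * f x) a m = c * shotNoise f a m := by
  unfold shotNoise
  rw [← ENNReal.tsum_mul_left]
  refine tsum_congr fun i => ?_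
  unfold pointValue
  split_ifs
  · ring
  · simp

variable {ρ : ℝ → ℝ}

theorem toReal_lintegral_radial (hρ : ∀ r, 0 ≤ r → 0 ≤ ρ r) (hρm : Measurable ρ) {g : ℝ → ℝ}
    (hg : ∀ r, 0 ≤ r → 0 ≤ g r) (hgm : Measurable g) {d : ℝ} (hd : 0 < d) :
    (∫⁻ x : Plane, (if d ≤ ‖x‖ then ENNReal.ofReal (g ‖x‖) else 0)
      ∂volume.withDensity fun x => ENNReal.ofReal (ρ ‖x‖)).toReal =
      2 * Real.pi * ∫ r in Ioi d, ρ r * g r * r := by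
  have hm : Measurable fun x : Plane => if d ≤ ‖x‖ then ENNReal.ofReal (g ‖x‖) else 0 :=
    Measurable.ite (measurableSet_le measurable_const measurable_norm) (by fun_prop)
      measurable_const
  rw [lintegral_withDensity_eq_lintegral_mul _ (by fun_prop) hm]
  have h1 : ∀ x : Plane, ((fun x : Plane => ENNReal.ofReal (ρ ‖x‖)) * fun x : Plane =>
      if d ≤ ‖x‖ then ENNReal.ofReal (g ‖x‖) else 0) x =
      ENNReal.ofReal ((Ici d).indicator (fun r => ρ r * g r) ‖x‖) := fun x => by
    simp only [Pi.mul_apply, indicator, mem_Ici]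
    split_ifs
    · rw [ENNReal.ofReal_mul (hρ _ (norm_nonneg x))]
    · simp
  simp_rw [h1]
  rw [← integral_eq_lintegral_of_nonneg_ae, integral_norm_plane fun r =>
    (Ici d).indicator (fun r => ρ r * g r) r]
  · congr 1
    have h2 : ∀ r, (Ici d).indicator (fun r => ρ r * g r) r * r =
        (Ici d).indicator (fun r => ρ r * g r * r) r := fun r => by
      simp only [indicator]; split_ifs <;> simp
    simp_rw [h2]
    rw [setIntegral_indicator measurableSet_Ici, inter_eq_right.2 (Ici_subset_Ioi.2 hd),
      integral_Ici_eq_integral_Ioi]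
  · exact ae_of_all _ fun x => indicator_nonneg (fun r hr =>
      mul_nonneg (hρ r (hd.le.trans hr)) (hg r (hd.le.trans hr))) _
  · exact (((hρm.mul hgm).indicator measurableSet_Ici).comp measurable_norm).aestronglyMeasurable

theorem lintegral_pathLoss_ne_top (hρ : ∀ r, 0 ≤ r → 0 ≤ ρ r) (hρm : Measurable ρ) {α d : ℝ}
    (hint : IntegrableOn (fun r => ρ r * r ^ (-α) * r) (Ioi d)) :
    ∫⁻ x, pathLoss α d x ∂volume.withDensity (fun x : Plane => ENNReal.ofReal (ρ ‖x‖)) ≠ ∞ := by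
  rw [lintegral_withDensity_eq_lintegral_mul _ (by fun_prop) (measurable_pathLoss α d)]
  have h1 : ∀ x : Plane, ((fun x : Plane => ENNReal.ofReal (ρ ‖x‖)) * pathLoss α d) x =
      ENNReal.ofReal ((Ici d).indicator (fun r => ρ r * r ^ (-α)) ‖x‖) := fun x => by
    simp only [Pi.mul_apply, indicator, mem_Ici, pathLoss]
    split_ifs
    · rw [ENNReal.ofReal_mul (hρ _ (norm_nonneg x))]
    · simp
  simp_rw [h1]
  have h2 : Integrable fun x : Plane => (Ici d).indicator (fun r => ρ r * r ^ (-α)) ‖x‖ := by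
    refine integrable_norm_plane ?_
    have h3 : ∀ r, (Ici d).indicator (fun r => ρ r * r ^ (-α)) r * r =
        (Ici d).indicator (fun r => ρ r * r ^ (-α) * r) r := fun r => by
      simp only [indicator]; split_ifs <;> simp
    simp_rw [h3]
    refine Integrable.integrableOn ?_
    rw [integrable_indicator_iff measurableSet_Ici, integrableOn_Ici_iff_integrableOn_Ioi]
    exact hint
  exact (h2.lintegral_lt_top).ne

end Radial

namespace Network

variable {K : ℕ} {Ω : Type*} {M : Network K Ω} {p : Params} {R : Fin (K + 1) → ℝ}

/-- The interference as a measurable function of the exclusion radius, the points and the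
marks. -/
def interfFun (p : Params) (R : Fin (K + 1) → ℝ) (j : Kind)
    (q : ℝ × ((ℕ∞ × (ℕ → Plane)) × (ℕ → ℝ))) : ℝ :=
  p.amplitude (R 0) j * (shotNoise (pathLoss (p.exponent j) q.1) q.2.1 q.2.2).toReal

theorem measurable_interfFun (p : Params) (R : Fin (K + 1) → ℝ) (j : Kind) :
    Measurable (interfFun p R j) :=
  (measurable_shotNoise_pathLoss _).ennreal_toReal.const_mul _

theorem _root_.CoopSensing.Params.Valid.amplitude_nonneg (hp : p.Valid) {R₁ : ℝ} (hR : 0 < R₁)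
    (j : Kind) : 0 ≤ p.amplitude R₁ j := by
  have h1 := hp.Ps_pos
  have h2 := hp.Pc_nonneg
  have h3 := hp.CL_pos
  have h4 := hp.CN_pos
  cases j <;> simp only [Params.amplitude] <;> positivity

theorem interfFun_nonneg (hp : p.Valid) (hR : 0 < R 0) (j : Kind)
    (q : ℝ × ((ℕ∞ × (ℕ → Plane)) × (ℕ → ℝ))) : 0 ≤ interfFun p R j q :=
  mul_nonneg (hp.amplitude_nonneg hR j) ENNReal.toReal_nonneg

theorem interfTerm_eq_toReal {j : Kind} {ω : Ω} (hω : ∀ i, 0 ≤ M.mark j i ω) (d : ℝ) (i : ℕ) :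
    M.interfTerm p j d ω i =
      (ENNReal.ofReal (M.marks j ω i) *
        pointValue (pathLoss (p.exponent j) d) (M.pts j ω) i).toReal := by
  unfold interfTerm pointValue pathLoss pts marks
  by_cases h1 : (i : ℕ∞) < M.count j ω <;> by_cases h2 : d ≤ ‖M.pos j i ω‖ <;>
    simp [h1, h2, ENNReal.toReal_mul, hω i, Real.rpow_nonneg]

/-- No summability is needed: if the sum diverges, the real `tsum` and the `toReal` of the extended
sum are both `0`. Nonnegative marks are needed because `ENNReal.ofReal` truncates. -/
theorem interf_eq_interfFun {j : Kind} {ω : Ω} (hω : ∀ i, 0 ≤ M.mark j i ω) (d : ℝ) :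
    M.interf p R j d ω = interfFun p R j (d, M.data j ω) := by
  unfold interf interfFun data shotNoise
  rw [ENNReal.tsum_toReal_eq fun i => ENNReal.mul_ne_top ENNReal.ofReal_ne_top
    (pointValue_ne_top (pathLoss_ne_top _ d) _ i)]
  simp_rw [interfTerm_eq_toReal hω]

variable [MeasurableSpace Ω] {P : Measure Ω}

theorem IsModel.ae_mark_nonneg (hM : M.IsModel p R P) :
    ∀ᵐ ω ∂P, ∀ j i, 0 ≤ M.mark j i ω := by
  have h : ∀ j, ∀ᵐ ω ∂P, ∀ i, 0 ≤ M.mark j i ω := fun j => ae_all_iff.2 fun i => by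
    refine ((hM.law_mark j i).ae_iff (p := fun x => 0 ≤ x)
      (measurableSet_setOfPred.1 measurableSet_Ici)).2 ?_
    rw [p.markLaw_eq]
    filter_upwards [ae_gammaMeasure_pos (p.markShape j) (p.markRate j)] with x hx using hx.le
  filter_upwards [h .target, h .los, h .nlos] with ω h1 h2 h3 j
  cases j
  exacts [h1, h2, h3]

theorem lintegral_mark_ne_top (hp : p.Valid) (j : Kind) :
    ∫⁻ x, ENNReal.ofReal x ∂p.markLaw j ≠ ∞ := by
  rw [p.markLaw_eq]
  have := integrable_rpow_gammaMeasure (hp.markShape_pos j) (hp.markRate_pos j) zero_le_one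
  simp only [Real.rpow_one] at this
  exact this.lintegral_lt_top.ne

theorem lintegral_pathLoss_intensity_ne_top (hp : p.Valid) (j : Kind) {d : ℝ} (hd : 0 < d) :
    ∫⁻ x, pathLoss (p.exponent j) d x ∂p.intensity j ≠ ∞ := by
  rw [p.intensity_eq]
  exact lintegral_pathLoss_ne_top (fun r hr => hp.radialDensity_nonneg j hr)
    (p.measurable_radialDensity j) (hp.integrableOn_radialDensity j hd)

theorem IsModel.ae_shotNoise_lt_top (hM : M.IsModel p R P) (hp : p.Valid) (j : Kind) {d : ℝ}
    (hd : 0 < d) :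
    ∀ᵐ ω ∂P, shotNoise (pathLoss (p.exponent j) d) (M.pts j ω) (M.marks j ω) < ∞ :=
  have := p.sigmaFinite_intensity j
  (hM.isMarkedPoisson j).ae_shotNoise_lt_top (measurable_pathLoss _ d)
    (lintegral_mark_ne_top hp j) (lintegral_pathLoss_intensity_ne_top hp j hd)

theorem shotNoise_pathLoss_anti (α : ℝ) {d d' : ℝ} (h : d ≤ d') (a : ℕ∞ × (ℕ → Plane))
    (m : ℕ → ℝ) : shotNoise (pathLoss α d') a m ≤ shotNoise (pathLoss α d) a m := by
  refine ENNReal.tsum_le_tsum fun i => mul_le_mul_right ?_ _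
  unfold pointValue pathLoss
  split_ifs <;> first | exact le_rfl | exact zero_le | skip
  linarith

theorem measurable_densRT (p : Params) (K : ℕ) (R₁ : ℝ) : Measurable (p.densRT K R₁) :=
  Measurable.ite measurableSet_Ici (by fun_prop) measurable_const

theorem measurable_densRI (p : Params) : Measurable p.densRI :=
  Measurable.ite measurableSet_Ioi (by fun_prop) measurable_const

theorem IsModel.ae_radI_pos (hM : M.IsModel p R P) : ∀ᵐ ω ∂P, 0 < M.radI ω := by
  refine (hM.law_radI.ae_iff (p := fun x => 0 < x) (measurableSet_setOfPred.1 measurableSet_Ioi)).2 ?_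
  rw [ae_withDensity_iff (measurable_densRI p).ennreal_ofReal]
  refine ae_of_all _ fun r hr => ?_
  by_contra h
  exact hr (by simp [Params.densRI, h])

theorem IsModel.ae_radT_ge (hM : M.IsModel p R P) : ∀ᵐ ω ∂P, R 0 ≤ M.radT ω := by
  refine (hM.law_radT.ae_iff (p := fun x => R 0 ≤ x)
    (measurableSet_setOfPred.1 measurableSet_Ici)).2 ?_
  rw [ae_withDensity_iff (measurable_densRT p K (R 0)).ennreal_ofReal]
  refine ae_of_all _ fun r hr => ?_
  by_contra h
  exact hr (by simp [Params.densRT, h])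

theorem IsModel.ae_radius_pos (hM : M.IsModel p R P) (hR : 0 < R 0) :
    ∀ᵐ ω ∂P, ∀ j, 0 < M.radius j ω := by
  filter_upwards [hM.ae_radI_pos, hM.ae_radT_ge] with ω h1 h2 j
  cases j
  exacts [hR.trans_le h2, h1, h1]

/-- The interference sums converge almost surely. -/
theorem IsModel.ae_summable (hM : M.IsModel p R P) (hp : p.Valid) (hR : 0 < R 0) :
    ∀ᵐ ω ∂P, ∀ j, Summable (M.interfTerm p j (M.radius j ω) ω) := by
  -- Finiteness is almost sure for each fixed radius. A random positive radius exceeds some `1 / (n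
  -- + 1)`, and the shot noise decreases in the radius, so countably many fixed radii suffice.
  have h : ∀ j, ∀ᵐ ω ∂P, ∀ n : ℕ,
      shotNoise (pathLoss (p.exponent j) (1 / (n + 1))) (M.pts j ω) (M.marks j ω) < ∞ :=
    fun j => ae_all_iff.2 fun n => hM.ae_shotNoise_lt_top hp j (by positivity)
  filter_upwards [hM.ae_radius_pos hR, hM.ae_mark_nonneg, h .target, h .los, h .nlos]
    with ω h1 h2 h3 h4 h5 j
  obtain ⟨n, hn⟩ := exists_nat_one_div_lt (h1 j)
  have hlt : shotNoise (pathLoss (p.exponent j) (1 / (n + 1))) (M.pts j ω) (M.marks j ω) < ∞ := by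
    cases j
    exacts [h3 n, h4 n, h5 n]
  have hlt' := (shotNoise_pathLoss_anti _ hn.le _ _).trans_lt hlt
  simp_rw [funext (interfTerm_eq_toReal (h2 j) (M.radius j ω))]
  exact ENNReal.summable_toReal hlt'.ne

/-! ### Laplace transforms of the interference -/

/-- The exponent of the Laplace transform of the interference at a fixed exclusion radius. -/
def lapExponent (p : Params) (R₁ : ℝ) (j : Kind) (s d : ℝ) : ℝ :=
  2 * Real.pi * ∫ r in Ioi d, p.radialDensity j r *
    (1 - (1 + s * p.amplitude R₁ j * r ^ (-p.exponent j) / p.markRate j) ^ (-p.markShape j)) * r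

/-- The marked Laplace functional at the scaled path loss, with the Gamma transform as `ψ`, followed
by polar coordinates. -/
theorem IsModel.integral_exp_neg_interfFun (hM : M.IsModel p R P) [IsProbabilityMeasure P]
    (hp : p.Valid) (hR : 0 < R 0) (j : Kind) {s d : ℝ} (hs : 0 ≤ s) (hd : 0 < d) :
    ∫ ω, Real.exp (-(s * interfFun p R j (d, M.data j ω))) ∂P =
      Real.exp (-lapExponent p (R 0) j s d) := by
  have hsf := p.sigmaFinite_intensity j
  have ha := hp.markShape_pos j
  have hr := hp.markRate_pos j
  have hA := hp.amplitude_nonneg hR j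
  set c := s * p.amplitude (R 0) j with hc
  have hc0 : 0 ≤ c := mul_nonneg hs hA
  set ψ : ℝ → ℝ := fun t => (1 + t / p.markRate j) ^ (-p.markShape j) with hψ
  have hψ1 : ∀ t, 0 ≤ t → ψ t ≤ 1 := fun t ht =>
    Real.rpow_le_one_of_one_le_of_nonpos (by linarith [div_nonneg ht hr.le]) (by linarith)
  have hlap := (hM.isMarkedPoisson j).integral_exp_neg_shotNoise
    (f := fun x => ENNReal.ofReal c * pathLoss (p.exponent j) d x)
    ((measurable_pathLoss _ d).const_mul _)
    (fun x => ENNReal.mul_ne_top ENNReal.ofReal_ne_top (pathLoss_ne_top _ d x))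
    (by
      rw [lintegral_const_mul _ (measurable_pathLoss _ d)]
      exact ENNReal.mul_ne_top ENNReal.ofReal_ne_top
        (lintegral_pathLoss_intensity_ne_top hp j hd))
    (by
      rw [p.markLaw_eq]
      filter_upwards [ae_gammaMeasure_pos (p.markShape j) (p.markRate j)] with x hx using hx.le)
    (lintegral_mark_ne_top hp j) (ψ := ψ) (by fun_prop)
    (fun t ht => by rw [p.markLaw_eq]; exact integral_exp_neg_gammaMeasure ha hr ht)
    -- `C` is the mean of the mark; the bound `exp (-(C * t)) ≤ ψ t` follows from `1 + u ≤ exp u`.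
    hψ1 (C := p.markShape j / p.markRate j) (by positivity)
    (fun t ht => by
      have h0 : 0 < 1 + t / p.markRate j := by positivity
      rw [hψ, show -(p.markShape j / p.markRate j * t) =
        (t / p.markRate j) * -p.markShape j by ring, Real.exp_mul]
      exact Real.rpow_le_rpow_of_nonpos h0 (by linarith [Real.add_one_le_exp (t / p.markRate j)])
        (by linarith))
  have hleft : ∀ ω, Real.exp (-(s * interfFun p R j (d, M.data j ω))) =
      Real.exp (-(shotNoise (fun x => ENNReal.ofReal c * pathLoss (p.exponent j) d x)
        (M.pts j ω) fun i => M.mark j i ω).toReal) := fun ω => by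
    rw [shotNoise_const_mul, ENNReal.toReal_mul, ENNReal.toReal_ofReal hc0, interfFun, ← mul_assoc]
    rfl
  simp_rw [hleft]
  rw [hlap]
  congr 2
  rw [lapExponent, p.intensity_eq, ← toReal_lintegral_radial
    (fun r hr => hp.radialDensity_nonneg j hr) (p.measurable_radialDensity j)
    (g := fun r => 1 - (1 + c * r ^ (-p.exponent j) / p.markRate j) ^ (-p.markShape j))
    (fun r hr' => sub_nonneg.2 (hψ1 (c * r ^ (-p.exponent j)) (by positivity))) (by fun_prop) hd]
  congr 1
  refine lintegral_congr fun x => ?_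
  unfold pathLoss
  split_ifs
  · rw [ENNReal.toReal_mul, ENNReal.toReal_ofReal hc0, ENNReal.toReal_ofReal (by positivity)]
  · simp [hψ]

end Network

namespace Network

variable {K : ℕ} {Ω : Type*} {M : Network K Ω} {p : Params} {R : Fin (K + 1) → ℝ}

theorem abs_exp_neg_interfFun_le (hp : p.Valid) (hR : 0 < R 0) {s : ℝ} (hs : 0 ≤ s) (j : Kind)
    (q : ℝ × ((ℕ∞ × (ℕ → Plane)) × (ℕ → ℝ))) :
    |Real.exp (-(s * interfFun p R j q))| ≤ 1 := by
  rw [Real.abs_exp]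
  exact Real.exp_le_one_iff.2 (neg_nonpos.2 (mul_nonneg hs (interfFun_nonneg hp hR j q)))

theorem densRI_nonneg (hp : p.Valid) (r : ℝ) : 0 ≤ p.densRI r := by
  have := hp.lamBS_pos
  unfold Params.densRI
  split_ifs <;> positivity

theorem densRT_nonneg (hp : p.Valid) {R₁ : ℝ} (hR : 0 < R₁) (r : ℝ) : 0 ≤ p.densRT K R₁ r := by
  have := hp.lamBS_pos
  unfold Params.densRT
  split_ifs with h
  · have h1 : 0 ≤ r ^ 2 - R₁ ^ 2 := sub_nonneg.2 (by gcongr)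
    have h2 : 0 ≤ r := hR.le.trans h
    positivity
  · exact le_rfl

/-! #### Closed forms of the exponents -/

theorem xi_eq (p : Params) : p.xi = 2 * Real.pi * p.lamI := by
  unfold Params.xi Params.lamI
  ring

theorem lapExponent_los (p : Params) (R₁ s d : ℝ) :
    lapExponent p R₁ .los s d = p.xi * p.JL s d := by
  rw [lapExponent, xi_eq, Params.JL, ← integral_const_mul, ← integral_const_mul]
  congr 1
  funext r
  simp only [Params.radialDensity, Params.amplitude, Params.exponent, Params.markRate,
    Params.markShape, mul_assoc]
  ring_nf

theorem lapExponent_nlos (p : Params) (R₁ s d : ℝ) :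
    lapExponent p R₁ .nlos s d = p.xi * p.JN s d := by
  rw [lapExponent, xi_eq, Params.JN, ← integral_const_mul, ← integral_const_mul]
  congr 1
  funext r
  simp only [Params.radialDensity, Params.amplitude, Params.exponent, Params.markRate,
    Params.markShape, mul_assoc]
  ring_nf

/-- The `2π` of polar coordinates cancels the one in the illumination fraction, and exponential
marks (Gamma of shape `1`) turn the power into a reciprocal. -/
theorem lapExponent_target (p : Params) (R₁ s : ℝ) {d : ℝ} (hd : 0 < d) :
    lapExponent p R₁ .target s d = p.lamBS * p.Nb * p.thetaB *
      ∫ r in Ioi d, p.pLOS r * (1 - 1 / (1 + s * p.muBi R₁ r)) * r := by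
  rw [lapExponent, ← integral_const_mul, ← integral_const_mul]
  refine setIntegral_congr_fun measurableSet_Ioi fun r hr => ?_
  have hr0 : 0 < r := hd.trans hr
  have h1 : s * p.amplitude R₁ .target * r ^ (-p.aL) / (1 / p.rcsBi) = s * p.muBi R₁ r := by
    rw [Params.amplitude, Params.muBi, Params.echoBi, Real.rpow_neg hr0.le]
    field_simp
  simp only [Params.radialDensity, Params.exponent, Params.markRate, Params.markShape]
  rw [h1, Real.rpow_neg_one, one_div]
  field_simp

/-! #### The interference at random exclusion radii -/

/-- The target-reflected interference, as a function of the random sources. -/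
def targetInterf (M : Network K Ω) (p : Params) (R : Fin (K + 1) → ℝ) (ω : Ω) : ℝ :=
  interfFun p R .target (M.radT ω, M.data .target ω)

/-- The co-channel interference, as a function of the random sources. -/
def directInterf (M : Network K Ω) (p : Params) (R : Fin (K + 1) → ℝ) (ω : Ω) : ℝ :=
  interfFun p R .los (M.radI ω, M.data .los ω) + interfFun p R .nlos (M.radI ω, M.data .nlos ω)

/-- Noise and residual self-interference. -/
def noisePower (p : Params) : ℝ := p.KB * p.T * p.W + p.Pc * p.zetaSI

theorem noisePower_pos (hp : p.Valid) : 0 < noisePower p :=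
  add_pos_of_pos_of_nonneg (mul_pos (mul_pos hp.KB_pos hp.T_pos) hp.W_pos)
    (mul_nonneg hp.Pc_nonneg hp.zetaSI_nonneg)

/-- The total interference, as a function of the random sources. -/
def totalInterf (M : Network K Ω) (p : Params) (R : Fin (K + 1) → ℝ) (ω : Ω) : ℝ :=
  M.targetInterf p R ω + M.directInterf p R ω + noisePower p

theorem targetInterf_nonneg (hp : p.Valid) (hR : 0 < R 0) (ω : Ω) : 0 ≤ M.targetInterf p R ω :=
  interfFun_nonneg hp hR _ _

theorem directInterf_nonneg (hp : p.Valid) (hR : 0 < R 0) (ω : Ω) : 0 ≤ M.directInterf p R ω :=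
  add_nonneg (interfFun_nonneg hp hR _ _) (interfFun_nonneg hp hR _ _)

theorem noisePower_le_totalInterf (hp : p.Valid) (hR : 0 < R 0) (ω : Ω) :
    noisePower p ≤ M.totalInterf p R ω := by
  have h1 := targetInterf_nonneg (M := M) hp hR ω
  have h2 := directInterf_nonneg (M := M) hp hR ω
  unfold totalInterf
  linarith

/-- The sources of randomness of the target-reflected interference. -/
def targetSources (K : ℕ) : Set (Source K) := insert .radT (dataSources K .target)

/-- The sources of randomness of the co-channel interference. -/
def directSources (K : ℕ) : Set (Source K) :=
  insert .radI (dataSources K .los ∪ dataSources K .nlos)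

/-- The sources of randomness of the echo power. -/
def echoSources (K : ℕ) : Set (Source K) :=
  {i | i = .mono ∨ (∃ n, i = .bi n) ∨ ∃ n, i = .lit n}

theorem measurable_gen_targetInterf {S : Set (Source K)} (hS : targetSources K ⊆ S) :
    Measurable[M.gen S] (M.targetInterf p R) :=
  (measurable_interfFun p R .target).comp (Measurable.prodMk (m := M.gen S)
    (measurable_gen_radT (hS (mem_insert _ _)))
    (measurable_gen_data ((subset_insert _ _).trans hS)))

theorem measurable_gen_directInterf {S : Set (Source K)} (hS : directSources K ⊆ S) :
    Measurable[M.gen S] (M.directInterf p R) := by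
  have hI : .radI ∈ S := hS (mem_insert _ _)
  refine Measurable.add (m := M.gen S) ?_ ?_
  · exact (measurable_interfFun p R .los).comp (Measurable.prodMk (m := M.gen S)
      (measurable_gen_radI hI)
      (measurable_gen_data ((subset_union_left.trans (subset_insert _ _)).trans hS)))
  · exact (measurable_interfFun p R .nlos).comp (Measurable.prodMk (m := M.gen S)
      (measurable_gen_radI hI)
      (measurable_gen_data ((subset_union_right.trans (subset_insert _ _)).trans hS)))

theorem measurable_gen_totalInterf :
    Measurable[M.gen (targetSources K ∪ directSources K)] (M.totalInterf p R) :=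
  Measurable.add_const (m := M.gen _) (Measurable.add (m := M.gen _)
    (measurable_gen_targetInterf subset_union_left)
    (measurable_gen_directInterf subset_union_right)) _

variable [MeasurableSpace Ω] {P : Measure Ω}

/-- Averaging over an independent radius with a density on `[a, ∞)`. -/
theorem integral_comp_radius [IsProbabilityMeasure P] {E : Type*} [MeasurableSpace E]
    {rad : Ω → ℝ} {Y : Ω → E} (hrad : Measurable rad) (hY : Measurable Y)
    (hind : IndepFun rad Y P) {f : ℝ → ℝ} (hf : Measurable f) (hf0 : ∀ r, 0 ≤ f r)
    (hlaw : HasLaw rad (volume.withDensity fun r => ENNReal.ofReal (f r)) P) {a : ℝ}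
    (hfa : ∀ r, r < a → f r = 0) {g : ℝ × E → ℝ} (hg : Measurable g) {C : ℝ}
    (hC : ∀ q, |g q| ≤ C) {Φ : ℝ → ℝ} (hΦ : ∀ d, a < d → ∫ ω, g (d, Y ω) ∂P = Φ d) :
    ∫ ω, g (rad ω, Y ω) ∂P = ∫ r in Ioi a, Φ r * f r := by
  rw [integral_comp_prodMk_of_indepFun hind hrad hY hg hC]
  have hm : StronglyMeasurable fun d => ∫ ω, g (d, Y ω) ∂P :=
    StronglyMeasurable.integral_prod_right' (f := fun q : ℝ × Ω => g (q.1, Y q.2))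
      (hg.comp (measurable_fst.prodMk (hY.comp measurable_snd))).stronglyMeasurable
  have h1 := hlaw.integral_comp hm.aestronglyMeasurable
  simp only [Function.comp_def] at h1
  rw [h1, integral_withDensity_eq_integral_toReal_smul hf.ennreal_ofReal (by simp),
    ← integral_Ici_eq_integral_Ioi, ← integral_indicator measurableSet_Ici]
  refine integral_congr_ae ?_
  -- The transform is known only for radii strictly above `a`; the endpoint is null.
  filter_upwards [Measure.ae_ne volume a] with r hr
  simp only [indicator, mem_Ici, smul_eq_mul]
  rw [ENNReal.toReal_ofReal (hf0 r)]
  split_ifs with h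
  · rw [hΦ r (lt_of_le_of_ne h (Ne.symm hr)), mul_comm]
  · rw [hfa r (not_le.1 h), zero_mul]

/-- Passes to a version that is measurable in the underlying sources, to which independence applies.
-/
theorem IsModel.ae_IT_eq (hM : M.IsModel p R P) : M.IT p R =ᵐ[P] M.targetInterf p R := by
  filter_upwards [hM.ae_mark_nonneg] with ω hω
  exact interf_eq_interfFun (hω _) _

theorem IsModel.ae_ILS_add_INS_eq (hM : M.IsModel p R P) :
    (fun ω => M.ILS p R ω + M.INS p R ω) =ᵐ[P] M.directInterf p R := by
  filter_upwards [hM.ae_mark_nonneg] with ω hω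
  exact congrArg₂ _ (interf_eq_interfFun (hω _) _) (interf_eq_interfFun (hω _) _)

theorem IsModel.ae_Itot_eq (hM : M.IsModel p R P) : M.Itot p R =ᵐ[P] M.totalInterf p R := by
  filter_upwards [hM.ae_IT_eq, hM.ae_ILS_add_INS_eq] with ω h1 h2
  rw [Itot, h1, totalInterf, ← h2, noisePower]
  ring

theorem IsModel.measurable_totalInterf (hM : M.IsModel p R P) :
    Measurable (M.totalInterf p R) :=
  measurable_gen_totalInterf.mono (hM.gen_le _) le_rfl

theorem IsModel.measurable_targetInterf (hM : M.IsModel p R P) :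
    Measurable (M.targetInterf p R) :=
  (measurable_gen_targetInterf subset_rfl).mono (hM.gen_le _) le_rfl

theorem IsModel.measurable_directInterf (hM : M.IsModel p R P) :
    Measurable (M.directInterf p R) :=
  (measurable_gen_directInterf subset_rfl).mono (hM.gen_le _) le_rfl

theorem disjoint_targetSources_directSources :
    Disjoint (targetSources K) (directSources K) := by
  rw [Set.disjoint_left]
  rintro i (rfl | rfl | ⟨n, rfl⟩) <;> simp [directSources, dataSources]

theorem disjoint_echoSources : Disjoint (echoSources K) (targetSources K ∪ directSources K) := by
  rw [Set.disjoint_left]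
  rintro i (rfl | ⟨n, rfl⟩ | ⟨n, rfl⟩) <;> simp [targetSources, directSources, dataSources]

variable [IsProbabilityMeasure P]

theorem IsModel.laplace_interf (hM : M.IsModel p R P) (hp : p.Valid) (hR : 0 < R 0) (j : Kind)
    {s d : ℝ} (hs : 0 ≤ s) (hd : 0 < d) :
    laplace P (M.interf p R j d) s = Real.exp (-lapExponent p (R 0) j s d) := by
  rw [← hM.integral_exp_neg_interfFun hp hR j hs hd, laplace]
  refine integral_congr_ae ?_
  filter_upwards [hM.ae_mark_nonneg] with ω hω
  rw [interf_eq_interfFun (hω j)]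

theorem IsModel.integral_exp_neg_targetInterf (hM : M.IsModel p R P) (hp : p.Valid)
    (hR : 0 < R 0) {s : ℝ} (hs : 0 ≤ s) :
    ∫ ω, Real.exp (-(s * M.targetInterf p R ω)) ∂P = p.ltTarget K (R 0) s := by
  have hind : IndepFun M.radT (M.data .target) P :=
    hM.indepFun (S := {.radT}) (T := dataSources K .target)
      (disjoint_singleton_left.2 (by simp [dataSources])) (measurable_gen_radT rfl)
      (measurable_gen_data subset_rfl)
  have hm := measurable_interfFun p R .target
  rw [Params.ltTarget]
  refine integral_comp_radius hM.measurable_radT (hM.measurable_data _) hind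
    (measurable_densRT p K (R 0)) (densRT_nonneg hp hR) hM.law_radT
    (fun r hr => by simp [Params.densRT, hr]) (g := fun q => Real.exp (-(s * interfFun p R .target q)))
    (by fun_prop) (abs_exp_neg_interfFun_le hp hR hs _) fun d hd => ?_
  rw [hM.integral_exp_neg_interfFun hp hR _ hs (hR.trans hd),
    lapExponent_target p _ s (hR.trans hd)]

/-- The LoS and NLoS sums share the radius `radI`; they are independent only once it is frozen, so
the product of transforms is formed before averaging over it. -/
theorem IsModel.integral_exp_neg_directInterf (hM : M.IsModel p R P) (hp : p.Valid)
    (hR : 0 < R 0) {s : ℝ} (hs : 0 ≤ s) :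
    ∫ ω, Real.exp (-(s * M.directInterf p R ω)) ∂P = p.ltDirect s := by
  have hind : IndepFun M.radI (fun ω => (M.data .los ω, M.data .nlos ω)) P :=
    hM.indepFun (S := {.radI}) (T := dataSources K .los ∪ dataSources K .nlos)
      (disjoint_singleton_left.2 (by simp [dataSources])) (measurable_gen_radI rfl)
      (Measurable.prodMk (m := M.gen _) (measurable_gen_data subset_union_left)
        (measurable_gen_data subset_union_right))
  have hind2 : IndepFun (M.data .los) (M.data .nlos) P :=
    hM.indepFun (S := dataSources K .los) (T := dataSources K .nlos)
      (by
        rw [Set.disjoint_left]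
        rintro i (rfl | ⟨n, rfl⟩) <;> simp [dataSources])
      (measurable_gen_data subset_rfl) (measurable_gen_data subset_rfl)
  have hmL := measurable_interfFun p R .los
  have hmN := measurable_interfFun p R .nlos
  have hexp : ∀ q : ℝ × (((ℕ∞ × (ℕ → Plane)) × (ℕ → ℝ)) × ((ℕ∞ × (ℕ → Plane)) × (ℕ → ℝ))),
      Real.exp (-(s * (interfFun p R .los (q.1, q.2.1) + interfFun p R .nlos (q.1, q.2.2)))) =
      Real.exp (-(s * interfFun p R .los (q.1, q.2.1))) *
        Real.exp (-(s * interfFun p R .nlos (q.1, q.2.2))) := fun q => by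
    rw [← Real.exp_add]; ring_nf
  rw [Params.ltDirect]
  refine integral_comp_radius (Y := fun ω => (M.data .los ω, M.data .nlos ω)) hM.measurable_radI
    ((hM.measurable_data _).prodMk (hM.measurable_data _)) hind
    (measurable_densRI p) (densRI_nonneg hp) hM.law_radI
    (fun r hr => by simp [Params.densRI, hr.le])
    (g := fun q => Real.exp (-(s * (interfFun p R .los (q.1, q.2.1) +
      interfFun p R .nlos (q.1, q.2.2))))) (by fun_prop) (C := 1) (fun q => ?_) fun d hd => ?_
  · rw [hexp, abs_mul]
    exact mul_le_one₀ (abs_exp_neg_interfFun_le hp hR hs _ _) (abs_nonneg _)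
      (abs_exp_neg_interfFun_le hp hR hs _ _)
  · rw [integral_congr_ae (ae_of_all _ fun ω => hexp (d, (M.data .los ω, M.data .nlos ω)))]
    have h1 := (hind2.comp (φ := fun a => Real.exp (-(s * interfFun p R .los (d, a))))
      (ψ := fun a => Real.exp (-(s * interfFun p R .nlos (d, a))))
      (by fun_prop) (by fun_prop)).integral_fun_mul_eq_mul_integral
      (Measurable.aestronglyMeasurable ((by fun_prop : Measurable fun a =>
        Real.exp (-(s * interfFun p R .los (d, a)))).comp (hM.measurable_data _)))
      (Measurable.aestronglyMeasurable ((by fun_prop : Measurable fun a =>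
        Real.exp (-(s * interfFun p R .nlos (d, a)))).comp (hM.measurable_data _)))
    simp only [Function.comp_def] at h1
    rw [h1, hM.integral_exp_neg_interfFun hp hR _ hs hd, hM.integral_exp_neg_interfFun hp hR _ hs hd,
      lapExponent_los, lapExponent_nlos, ← Real.exp_add]
    ring_nf

theorem IsModel.laplace_IT (hM : M.IsModel p R P) (hp : p.Valid) (hR : 0 < R 0) {s : ℝ}
    (hs : 0 ≤ s) : laplace P (M.IT p R) s = p.ltTarget K (R 0) s := by
  rw [← hM.integral_exp_neg_targetInterf hp hR hs, laplace]
  refine integral_congr_ae ?_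
  filter_upwards [hM.ae_IT_eq] with ω hω
  rw [hω]

theorem IsModel.laplace_ILS_add_INS (hM : M.IsModel p R P) (hp : p.Valid) (hR : 0 < R 0) {s : ℝ}
    (hs : 0 ≤ s) : laplace P (fun ω => M.ILS p R ω + M.INS p R ω) s = p.ltDirect s := by
  rw [← hM.integral_exp_neg_directInterf hp hR hs, laplace]
  refine integral_congr_ae ?_
  filter_upwards [hM.ae_ILS_add_INS_eq] with ω hω
  rw [hω]

/-- The Laplace transform of the total interference. -/
theorem IsModel.integral_exp_neg_totalInterf (hM : M.IsModel p R P) (hp : p.Valid)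
    (hR : 0 < R 0) {s : ℝ} (hs : 0 ≤ s) :
    ∫ ω, Real.exp (-(s * M.totalInterf p R ω)) ∂P =
      p.ltTarget K (R 0) s * p.ltDirect s * Real.exp (-(s * noisePower p)) := by
  have hexp : ∀ ω, Real.exp (-(s * M.totalInterf p R ω)) =
      Real.exp (-(s * M.targetInterf p R ω)) * Real.exp (-(s * M.directInterf p R ω)) *
        Real.exp (-(s * noisePower p)) := fun ω => by
    rw [← Real.exp_add, ← Real.exp_add, totalInterf]; ring_nf
  simp_rw [hexp]
  have hind : IndepFun (M.targetInterf p R) (M.directInterf p R) P :=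
    hM.indepFun disjoint_targetSources_directSources (measurable_gen_targetInterf subset_rfl)
      (measurable_gen_directInterf subset_rfl)
  have hm : Measurable fun x : ℝ => Real.exp (-(s * x)) := by fun_prop
  have h1 := (hind.comp hm hm).integral_fun_mul_eq_mul_integral
    (hm.comp hM.measurable_targetInterf).aestronglyMeasurable
    (hm.comp hM.measurable_directInterf).aestronglyMeasurable
  simp only [Function.comp_def] at h1
  rw [integral_mul_const, h1, hM.integral_exp_neg_targetInterf hp hR hs,
    hM.integral_exp_neg_directInterf hp hR hs]

end Network

/-! ### Moments of the echo power -/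

namespace Network

variable {K : ℕ} {Ω : Type*} {M : Network K Ω} {p : Params} {R : Fin (K + 1) → ℝ}

/-- Echo power through a candidate cooperating BS. -/
def bistaticEcho (M : Network K Ω) (p : Params) (R : Fin (K + 1) → ℝ) (n : Fin K) : Ω → ℝ :=
  (M.lit n).indicator fun ω => p.echoBi (R 0) (R n.succ) * M.rcsBi n ω

theorem Ptot_eq (M : Network K Ω) (p : Params) (R : Fin (K + 1) → ℝ) :
    M.Ptot p R = (fun ω => p.echoMono (R 0) * M.rcsMono ω) + ∑ n, M.bistaticEcho p R n := by
  ext ω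
  simp [Ptot, bistaticEcho]

theorem measurable_gen_bistaticEcho {S : Set (Source K)} {n : Fin K} (h1 : .bi n ∈ S)
    (h2 : .lit n ∈ S) : Measurable[M.gen S] (M.bistaticEcho p R n) :=
  Measurable.indicator (Measurable.const_mul (m := M.gen S) (measurable_gen_rcsBi h1) _)
    (measurableSet_gen_lit h2)

theorem measurable_gen_sum_bistaticEcho {S : Set (Source K)} (h1 : ∀ n, .bi n ∈ S)
    (h2 : ∀ n, .lit n ∈ S) : Measurable[M.gen S] (∑ n, M.bistaticEcho p R n) := by
  rw [show ∑ n, M.bistaticEcho p R n = fun ω => ∑ n, M.bistaticEcho p R n ω by ext; simp]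
  exact Finset.measurable_sum (m := M.gen S) _ fun n _ => measurable_gen_bistaticEcho (h1 n) (h2 n)

theorem measurable_gen_Ptot : Measurable[M.gen (echoSources K)] (M.Ptot p R) := by
  rw [Ptot_eq]
  exact Measurable.add (m := M.gen _)
    (Measurable.const_mul (m := M.gen _) (measurable_gen_rcsMono (Or.inl rfl)) _)
    (measurable_gen_sum_bistaticEcho (fun n => Or.inr (Or.inl ⟨n, rfl⟩))
      fun n => Or.inr (Or.inr ⟨n, rfl⟩))

variable [MeasurableSpace Ω] {P : Measure Ω}

theorem IsModel.measurable_Ptot (hM : M.IsModel p R P) : Measurable (M.Ptot p R) :=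
  measurable_gen_Ptot.mono (hM.gen_le _) le_rfl

section Exponential

variable {X : Ω → ℝ} {σ : ℝ}

theorem memLp_two_of_hasLaw_expMeasure (hσ : 0 < σ) (h : HasLaw X (expMeasure (1 / σ)) P)
    (hX : Measurable X) : MemLp X 2 P :=
  (memLp_id_gammaMeasure one_pos (one_div_pos.2 hσ)).comp_measurePreserving
    (h.measurePreserving hX)

theorem integral_of_hasLaw_expMeasure (hσ : 0 < σ) (h : HasLaw X (expMeasure (1 / σ)) P) :
    ∫ ω, X ω ∂P = σ := by
  have h1 := h.integral_comp (f := fun x => x) measurable_id'.aestronglyMeasurable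
  simp only [Function.comp_def] at h1
  rw [h1, expMeasure, integral_id_gammaMeasure one_pos (one_div_pos.2 hσ)]
  field_simp

theorem integral_sq_of_hasLaw_expMeasure (hσ : 0 < σ) (h : HasLaw X (expMeasure (1 / σ)) P) :
    ∫ ω, X ω ^ 2 ∂P = 2 * σ ^ 2 := by
  have h1 := h.integral_comp (f := fun x => x ^ 2)
    (Measurable.aestronglyMeasurable (by fun_prop))
  simp only [Function.comp_def] at h1
  rw [h1, expMeasure, integral_sq_gammaMeasure one_pos (one_div_pos.2 hσ)]
  field_simp
  norm_num

end Exponential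

theorem IsModel.memLp_bistaticEcho (hM : M.IsModel p R P) (hp : p.Valid) (n : Fin K) :
    MemLp (M.bistaticEcho p R n) 2 P :=
  ((memLp_two_of_hasLaw_expMeasure hp.rcsBi_pos (hM.law_rcsBi n)
    (hM.measurable_rcsBi n)).const_mul _).indicator (hM.measurable_lit n)

theorem IsModel.memLp_Ptot (hM : M.IsModel p R P) (hp : p.Valid) : MemLp (M.Ptot p R) 2 P := by
  rw [Ptot_eq]
  exact ((memLp_two_of_hasLaw_expMeasure hp.rcsMono_pos hM.law_rcsMono
    hM.measurable_rcsMono).const_mul _).add (memLp_finsetSum' _ fun n _ => hM.memLp_bistaticEcho hp n)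

theorem IsModel.indepFun_rcsMono_sum_bistaticEcho (hM : M.IsModel p R P) :
    IndepFun (fun ω => p.echoMono (R 0) * M.rcsMono ω) (∑ n, M.bistaticEcho p R n) P := by
  set T : Set (Source K) := {i | (∃ n, i = .bi n) ∨ ∃ n, i = .lit n} with hT
  have hdisj : Disjoint {.mono} T := disjoint_singleton_left.2 (by simp [hT])
  have h1 : Measurable[M.gen {.mono}] fun ω => p.echoMono (R 0) * M.rcsMono ω :=
    (measurable_const_mul _).comp (measurable_gen_rcsMono (mem_singleton _))
  have h2 : Measurable[M.gen T] (∑ n, M.bistaticEcho p R n) :=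
    measurable_gen_sum_bistaticEcho (fun n => Or.inl ⟨n, rfl⟩) fun n => Or.inr ⟨n, rfl⟩
  exact hM.indepFun hdisj h1 h2

theorem IsModel.indepFun_bistaticEcho (hM : M.IsModel p R P) {m n : Fin K} (hmn : m ≠ n) :
    IndepFun (M.bistaticEcho p R m) (M.bistaticEcho p R n) P := by
  have hdisj : Disjoint ({.bi m, .lit m} : Set (Source K)) {.bi n, .lit n} := by
    rw [Set.disjoint_left]
    rintro i (rfl | rfl) <;> simp [hmn]
  exact hM.indepFun hdisj (measurable_gen_bistaticEcho (Or.inl rfl) (Or.inr rfl))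
    (measurable_gen_bistaticEcho (Or.inl rfl) (Or.inr rfl))

/-- The illumination event is independent of the cross section, so restricting to it costs the
factor `pLit`. Used for the first and second moments. -/
theorem IsModel.setIntegral_lit (hM : M.IsModel p R P) (n : Fin K) {f : ℝ → ℝ}
    (hf : Measurable f) :
    ∫ ω in M.lit n, f (M.rcsBi n ω) ∂P = p.pLit (R n.succ) * ∫ ω, f (M.rcsBi n ω) ∂P := by
  have hind := hM.indep.indep (i := .lit n) (j := .bi n) (by simp)
  have h := Indep.setIntegral_eq_smul (hM.sigma_le _) hind (hM.measurable_rcsBi n).aemeasurable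
    (MeasurableSpace.measurableSet_generateFrom rfl) hf.aestronglyMeasurable
  rw [h, hM.prob_lit n, smul_eq_mul]

theorem IsModel.integral_bistaticEcho (hM : M.IsModel p R P) (hp : p.Valid) (n : Fin K) :
    ∫ ω, M.bistaticEcho p R n ω ∂P = p.pLit (R n.succ) * p.muBi (R 0) (R n.succ) := by
  unfold bistaticEcho
  rw [integral_indicator (hM.measurable_lit n), integral_const_mul,
    hM.setIntegral_lit n measurable_id', integral_of_hasLaw_expMeasure hp.rcsBi_pos (hM.law_rcsBi n),
    Params.muBi]
  ring

variable [IsProbabilityMeasure P]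

/-- An exponential variable has second moment twice its squared mean, whence `p * 2μ² - (pμ)²`, with
`p` the illumination probability and `μ` the mean echo. -/
theorem IsModel.variance_bistaticEcho (hM : M.IsModel p R P) (hp : p.Valid) (n : Fin K) :
    variance (M.bistaticEcho p R n) P = p.pLit (R n.succ) * (2 - p.pLit (R n.succ)) *
      p.muBi (R 0) (R n.succ) ^ 2 := by
  rw [variance_eq_sub (hM.memLp_bistaticEcho hp n), hM.integral_bistaticEcho hp]
  have h1 : M.bistaticEcho p R n ^ 2 = (M.lit n).indicator fun ω =>
      p.echoBi (R 0) (R n.succ) ^ 2 * M.rcsBi n ω ^ 2 := by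
    ext ω
    simp only [bistaticEcho, Pi.pow_apply, indicator]
    split_ifs <;> ring
  rw [h1, integral_indicator (hM.measurable_lit n), integral_const_mul,
    hM.setIntegral_lit n (f := fun x => x ^ 2) (by fun_prop),
    integral_sq_of_hasLaw_expMeasure hp.rcsBi_pos (hM.law_rcsBi n), Params.muBi]
  ring

theorem IsModel.integral_Ptot (hM : M.IsModel p R P) (hp : p.Valid) :
    ∫ ω, M.Ptot p R ω ∂P =
      p.muMono (R 0) + ∑ n : Fin K, p.pLit (R n.succ) * p.muBi (R 0) (R n.succ) := by
  have hi : ∀ n, Integrable (M.bistaticEcho p R n) P := fun n =>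
    (hM.memLp_bistaticEcho hp n).integrable one_le_two
  have h0 : Integrable (fun ω => p.echoMono (R 0) * M.rcsMono ω) P :=
    ((memLp_two_of_hasLaw_expMeasure hp.rcsMono_pos hM.law_rcsMono
      hM.measurable_rcsMono).integrable one_le_two).const_mul _
  rw [Ptot_eq, integral_add' h0 (integrable_finsetSum' _ fun n _ => hi n), integral_const_mul,
    integral_of_hasLaw_expMeasure hp.rcsMono_pos hM.law_rcsMono]
  simp only [Finset.sum_apply]
  rw [integral_finsetSum _ fun n _ => hi n]
  simp_rw [hM.integral_bistaticEcho hp]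
  rfl

theorem IsModel.variance_Ptot (hM : M.IsModel p R P) (hp : p.Valid) :
    variance (M.Ptot p R) P = p.muMono (R 0) ^ 2 +
      ∑ n : Fin K, p.pLit (R n.succ) * (2 - p.pLit (R n.succ)) * p.muBi (R 0) (R n.succ) ^ 2 := by
  have hmono := memLp_two_of_hasLaw_expMeasure hp.rcsMono_pos hM.law_rcsMono hM.measurable_rcsMono
  rw [Ptot_eq, hM.indepFun_rcsMono_sum_bistaticEcho.variance_add (hmono.const_mul _)
    (memLp_finsetSum' _ fun n _ => hM.memLp_bistaticEcho hp n),
    IndepFun.variance_sum (fun n _ => hM.memLp_bistaticEcho hp n)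
      (fun m _ n _ hmn => hM.indepFun_bistaticEcho hmn), variance_const_mul,
    variance_eq_sub hmono]
  simp only [Pi.pow_apply]
  rw [integral_sq_of_hasLaw_expMeasure hp.rcsMono_pos hM.law_rcsMono,
    integral_of_hasLaw_expMeasure hp.rcsMono_pos hM.law_rcsMono, Params.muMono]
  simp_rw [hM.variance_bistaticEcho hp]
  ring

end Network

namespace Params

variable {p : Params}

theorem Valid.pLit_nonneg (hp : p.Valid) (r : ℝ) : 0 ≤ p.pLit r := by
  have h1 := p.pLOS_pos r
  have h2 := hp.thetaB_pos
  unfold pLit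
  positivity

theorem Valid.pLit_le_one (hp : p.Valid) {r : ℝ} (hr : 0 ≤ r) : p.pLit r ≤ 1 :=
  mul_le_one₀ (hp.pLOS_le_one hr) (by have := hp.thetaB_pos; positivity)
    (div_le_one_of_le₀ hp.beams_le (by positivity))

theorem Valid.muMono_pos (hp : p.Valid) {R₁ : ℝ} (hR : 0 < R₁) : 0 < p.muMono R₁ := by
  have h1 := hp.Ps_pos
  have h2 := hp.Gm_pos
  have h3 := hp.wl_pos
  have h4 := hp.rcsMono_pos
  unfold muMono echoMono
  positivity

theorem Valid.muBi_pos (hp : p.Valid) {R₁ R : ℝ} (hR₁ : 0 < R₁) (hR : 0 < R) :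
    0 < p.muBi R₁ R := by
  have h1 := hp.Ps_pos
  have h2 := hp.Gm_pos
  have h3 := hp.wl_pos
  have h4 := hp.rcsBi_pos
  unfold muBi echoBi
  positivity

end Params

/-! ### The moment-matched Gamma law -/

namespace Network

variable {K : ℕ} {Ω : Type*} [MeasurableSpace Ω] {M : Network K Ω} {p : Params}
  {R : Fin (K + 1) → ℝ} {P : Measure Ω} [IsProbabilityMeasure P]

theorem IsModel.integral_Ptot_pos (hM : M.IsModel p R P) (hp : p.Valid) (hR₀ : 0 < R 0)
    (hR : StrictMono R) : 0 < ∫ ω, M.Ptot p R ω ∂P := by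
  rw [hM.integral_Ptot hp]
  refine add_pos_of_pos_of_nonneg (hp.muMono_pos hR₀) (Finset.sum_nonneg fun n _ => ?_)
  exact mul_nonneg (hp.pLit_nonneg _) (hp.muBi_pos hR₀ (hR₀.trans (hR n.succ_pos))).le

theorem IsModel.variance_Ptot_pos (hM : M.IsModel p R P) (hp : p.Valid) (hR₀ : 0 < R 0)
    (hR : StrictMono R) : 0 < variance (M.Ptot p R) P := by
  rw [hM.variance_Ptot hp]
  have hmu := hp.muMono_pos hR₀
  refine add_pos_of_pos_of_nonneg (by positivity) (Finset.sum_nonneg fun n _ => ?_)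
  have h1 := hp.pLit_nonneg (R n.succ)
  have h2 := hp.pLit_le_one (hR₀.trans (hR n.succ_pos)).le
  exact mul_nonneg (mul_nonneg h1 (by linarith)) (sq_nonneg _)

theorem IsModel.kEff_pos (hM : M.IsModel p R P) (hp : p.Valid) (hR₀ : 0 < R 0)
    (hR : StrictMono R) : 0 < M.kEff p R P :=
  div_pos (pow_pos (hM.integral_Ptot_pos hp hR₀ hR) 2) (hM.variance_Ptot_pos hp hR₀ hR)

theorem IsModel.thetaEff_pos (hM : M.IsModel p R P) (hp : p.Valid) (hR₀ : 0 < R 0)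
    (hR : StrictMono R) : 0 < M.thetaEff p R P :=
  div_pos (hM.variance_Ptot_pos hp hR₀ hR) (hM.integral_Ptot_pos hp hR₀ hR)

theorem IsModel.eta_pos (hM : M.IsModel p R P) (hp : p.Valid) (hR₀ : 0 < R 0)
    (hR : StrictMono R) : 0 < M.eta p R P :=
  Real.rpow_pos_of_pos (Real.Gamma_pos_of_pos (by linarith [hM.kEff_pos hp hR₀ hR])) _

theorem IsModel.isProbabilityMeasure_gammaLaw (hM : M.IsModel p R P) (hp : p.Valid)
    (hR₀ : 0 < R 0) (hR : StrictMono R) : IsProbabilityMeasure (M.gammaLaw p R P) :=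
  isProbabilityMeasure_gammaMeasure (hM.kEff_pos hp hR₀ hR) (inv_pos.2 (hM.thetaEff_pos hp hR₀ hR))

theorem IsModel.integral_gammaLaw (hM : M.IsModel p R P) (hp : p.Valid) (hR₀ : 0 < R 0)
    (hR : StrictMono R) : ∫ x, x ∂(M.gammaLaw p R P) = ∫ ω, M.Ptot p R ω ∂P := by
  have h1 := hM.integral_Ptot_pos hp hR₀ hR
  have h2 := hM.variance_Ptot_pos hp hR₀ hR
  rw [gammaLaw, integral_id_gammaMeasure (hM.kEff_pos hp hR₀ hR)
    (inv_pos.2 (hM.thetaEff_pos hp hR₀ hR)), kEff, thetaEff]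
  field_simp

theorem IsModel.variance_gammaLaw (hM : M.IsModel p R P) (hp : p.Valid) (hR₀ : 0 < R 0)
    (hR : StrictMono R) : variance id (M.gammaLaw p R P) = variance (M.Ptot p R) P := by
  have h1 := hM.integral_Ptot_pos hp hR₀ hR
  have h2 := hM.variance_Ptot_pos hp hR₀ hR
  rw [gammaLaw, variance_id_gammaMeasure (hM.kEff_pos hp hR₀ hR)
    (inv_pos.2 (hM.thetaEff_pos hp hR₀ hR)), kEff, thetaEff]
  field_simp

end Network

/-! ### Coverage probabilities -/

namespace Network

variable {K : ℕ} {Ω : Type*} [MeasurableSpace Ω] {M : Network K Ω} {p : Params}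
  {R : Fin (K + 1) → ℝ} {P : Measure Ω}

/-- Monotonicity provides the measurability of tails as functions of the threshold. -/
theorem antitone_measureReal_lt {E : Type*} [MeasurableSpace E] (μ : Measure E) [IsFiniteMeasure μ]
    (X : E → ℝ) : Antitone fun x => μ.real {e | x < X e} :=
  fun _ _ hxy => measureReal_mono fun _ he => lt_of_le_of_lt hxy he

theorem IsModel.ae_noisePower_le_Itot (hM : M.IsModel p R P) (hp : p.Valid) (hR : 0 < R 0) :
    ∀ᵐ ω ∂P, noisePower p ≤ M.Itot p R ω := by
  filter_upwards [hM.ae_Itot_eq] with ω hω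
  rw [hω]
  exact noisePower_le_totalInterf hp hR ω

theorem IsModel.ae_Itot_pos (hM : M.IsModel p R P) (hp : p.Valid) (hR : 0 < R 0) :
    ∀ᵐ ω ∂P, 0 < M.Itot p R ω := by
  filter_upwards [hM.ae_noisePower_le_Itot hp hR] with ω hω using (noisePower_pos hp).trans_le hω

theorem IsModel.aemeasurable_Itot (hM : M.IsModel p R P) : AEMeasurable (M.Itot p R) P :=
  ⟨_, hM.measurable_totalInterf, hM.ae_Itot_eq⟩

/-- A function that is measurable and bounded on `[0, ∞)` is integrable at the scaled
interference. -/
theorem IsModel.integrable_comp_Itot (hM : M.IsModel p R P) [IsProbabilityMeasure P]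
    (hp : p.Valid) (hR : 0 < R 0) {τ : ℝ} (hτ : 0 < τ) {f : ℝ → ℝ} (hf : Measurable f) {C : ℝ}
    (hC : ∀ x, 0 ≤ x → |f x| ≤ C) : Integrable (fun ω => f (τ * M.Itot p R ω)) P := by
  refine Integrable.of_bound
    (hf.comp_aemeasurable (hM.aemeasurable_Itot.const_mul τ)).aestronglyMeasurable C ?_
  filter_upwards [hM.ae_Itot_pos hp hR] with ω hω
  exact hC _ (by positivity)

/-- The coverage as the average of the tail of the echo power. -/
theorem IsModel.coverage_eq (hM : M.IsModel p R P) [IsProbabilityMeasure P] (hp : p.Valid)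
    (hR : 0 < R 0) (τ : ℝ) :
    M.coverage p R P τ = ∫ ω, P.real {ω' | τ * M.Itot p R ω < M.Ptot p R ω'} ∂P := by
  have hs : MeasurableSet {q : ℝ × ℝ | τ * q.1 < q.2} :=
    measurableSet_lt (by fun_prop) (by fun_prop)
  have hind : IndepFun (M.totalInterf p R) (M.Ptot p R) P :=
    (hM.indepFun disjoint_echoSources measurable_gen_Ptot measurable_gen_totalInterf).symm
  have h1 := integral_comp_prodMk_of_indepFun hind hM.measurable_totalInterf hM.measurable_Ptot
    (g := {q : ℝ × ℝ | τ * q.1 < q.2}.indicator 1) (measurable_one.indicator hs) (C := 1)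
    fun q => by
      by_cases h : q ∈ {q : ℝ × ℝ | τ * q.1 < q.2} <;> simp [h]
  have hI : ∀ A : Set Ω, MeasurableSet A → ∫ ω, A.indicator (1 : Ω → ℝ) ω ∂P = P.real A :=
    fun _ hA => integral_indicator_one hA
  have h2 : M.coverage p R P τ = P.real {ω | τ * M.totalInterf p R ω < M.Ptot p R ω} := by
    -- Clearing the denominator needs `Itot > 0`, which holds almost surely because of the noise.
    refine measureReal_congr ?_
    filter_upwards [hM.ae_Itot_eq, hM.ae_Itot_pos hp hR] with ω h1 h2
    refine propext ?_
    change τ < M.Ptot p R ω / M.Itot p R ω ↔ τ * M.totalInterf p R ω < M.Ptot p R ω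
    rw [lt_div_iff₀ h2, h1]
  rw [h2, ← hI {ω | τ * M.totalInterf p R ω < M.Ptot p R ω}
    (hs.preimage (hM.measurable_totalInterf.prodMk hM.measurable_Ptot))]
  refine h1.trans (integral_congr_ae ?_)
  filter_upwards [hM.ae_Itot_eq] with ω hω
  rw [hω, ← hI {ω' | τ * M.totalInterf p R ω < M.Ptot p R ω'}
    (hs.preimage (measurable_const.prodMk hM.measurable_Ptot))]
  rfl

/-- The coverage for the Gamma law as the average of the tail of the Gamma law. -/
theorem IsModel.gammaCoverage_eq (hM : M.IsModel p R P) [IsProbabilityMeasure P] (hp : p.Valid)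
    (hR₀ : 0 < R 0) (hR : StrictMono R) (τ : ℝ) :
    M.gammaCoverage p R P τ = ∫ ω, (M.gammaLaw p R P).real (Ioi (τ * M.Itot p R ω)) ∂P := by
  have hG := hM.isProbabilityMeasure_gammaLaw hp hR₀ hR
  have hmeas := hM.measurable_totalInterf
  have hs : MeasurableSet {q : ℝ × Ω | τ * M.totalInterf p R q.2 < q.1} :=
    measurableSet_lt (by fun_prop) (by fun_prop)
  have h2 : M.gammaCoverage p R P τ =
      ((M.gammaLaw p R P).prod P).real {q | τ * M.totalInterf p R q.2 < q.1} := by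
    refine measureReal_congr ?_
    have h3 := Measure.quasiMeasurePreserving_snd (μ := M.gammaLaw p R P) (ν := P)
    filter_upwards [h3.ae hM.ae_Itot_eq, h3.ae (hM.ae_Itot_pos hp hR₀)] with q h1 h2
    refine propext ?_
    change τ < q.1 / M.Itot p R q.2 ↔ τ * M.totalInterf p R q.2 < q.1
    rw [lt_div_iff₀ h2, h1]
  rw [h2, measureReal_def, Measure.prod_apply_symm hs, ← integral_toReal
    (measurable_measure_prodMk_right hs).aemeasurable (ae_of_all _ fun _ => measure_lt_top _ _)]
  refine integral_congr_ae ?_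
  filter_upwards [hM.ae_Itot_eq] with ω hω
  rw [hω]
  rfl

/-! ### Alzer's bound at the interference and the coverage series -/

theorem alzer_eq (M : Network K Ω) (p : Params) (R : Fin (K + 1) → ℝ) (P : Measure Ω) (x : ℝ) :
    M.alzer p R P x =
      1 - (1 - Real.exp (-(M.eta p R P * (M.thetaEff p R P)⁻¹ * x))) ^ M.kEff p R P := by
  rw [alzer, div_eq_mul_inv, mul_right_comm]

theorem measurable_alzer (M : Network K Ω) (p : Params) (R : Fin (K + 1) → ℝ) (P : Measure Ω) :
    Measurable (M.alzer p R P) := by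
  unfold alzer
  fun_prop

variable [IsProbabilityMeasure P]

theorem IsModel.gammaLaw_tail_alzer (hM : M.IsModel p R P) (hp : p.Valid) (hR₀ : 0 < R 0)
    (hR : StrictMono R) {x : ℝ} (hx : 0 ≤ x) :
    (1 ≤ M.kEff p R P → (M.gammaLaw p R P).real (Ioi x) ≤ M.alzer p R P x) ∧
    (M.kEff p R P ≤ 1 → M.alzer p R P x ≤ (M.gammaLaw p R P).real (Ioi x)) := by
  rw [alzer_eq]
  exact alzer_inequality (hM.kEff_pos hp hR₀ hR) (inv_pos.2 (hM.thetaEff_pos hp hR₀ hR)) rfl hx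

theorem IsModel.abs_alzer_le (hM : M.IsModel p R P) (hp : p.Valid) (hR₀ : 0 < R 0)
    (hR : StrictMono R) {x : ℝ} (hx : 0 ≤ x) : |M.alzer p R P x| ≤ 1 := by
  have hk := hM.kEff_pos hp hR₀ hR
  have hθ := hM.thetaEff_pos hp hR₀ hR
  have hη := hM.eta_pos hp hR₀ hR
  have h1 : Real.exp (-(M.eta p R P * x / M.thetaEff p R P)) ≤ 1 :=
    Real.exp_le_one_iff.2 (neg_nonpos.2 (by positivity))
  have h2 := Real.exp_pos (-(M.eta p R P * x / M.thetaEff p R P))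
  have h3 : 0 ≤ (1 - Real.exp (-(M.eta p R P * x / M.thetaEff p R P))) ^ M.kEff p R P :=
    Real.rpow_nonneg (by linarith) _
  have h4 : (1 - Real.exp (-(M.eta p R P * x / M.thetaEff p R P))) ^ M.kEff p R P ≤ 1 :=
    Real.rpow_le_one (by linarith) (by linarith) hk.le
  rw [alzer, abs_le]
  constructor <;> linarith

/-- Since `sArg` is linear in `z`, the exponentials are powers of a single base, which is what the
binomial series requires. -/
theorem exp_neg_sArg_mul (M : Network K Ω) (p : Params) (R : Fin (K + 1) → ℝ) (P : Measure Ω)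
    (τ x : ℝ) (z : ℕ+) : Real.exp (-(M.sArg p R P τ z * x)) =
      Real.exp (-(M.eta p R P * (τ * x) / M.thetaEff p R P)) ^ (z : ℕ) := by
  rw [← Real.exp_nat_mul, sArg]
  ring_nf

theorem IsModel.abs_exp_neg_lt_one (hM : M.IsModel p R P) (hp : p.Valid) (hR₀ : 0 < R 0)
    (hR : StrictMono R) {x : ℝ} (hx : 0 < x) :
    |Real.exp (-(M.eta p R P * x / M.thetaEff p R P))| < 1 := by
  have hθ := hM.thetaEff_pos hp hR₀ hR
  have hη := hM.eta_pos hp hR₀ hR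
  rw [Real.abs_exp]
  exact Real.exp_lt_one_iff.2 (neg_neg_of_pos (by positivity))

/-- The binomial expansion of Alzer's expression. -/
theorem IsModel.hasSum_alzer (hM : M.IsModel p R P) (hp : p.Valid) (hR₀ : 0 < R 0)
    (hR : StrictMono R) {τ x : ℝ} (hτ : 0 < τ) (hx : 0 < x) :
    HasSum (fun z : ℕ+ => Ring.choose (M.kEff p R P) (z : ℕ) * (-1) ^ ((z : ℕ) + 1) *
      Real.exp (-(M.sArg p R P τ z * x))) (M.alzer p R P (τ * x)) := by
  simp_rw [exp_neg_sArg_mul]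
  exact hasSum_pnat_choose_mul_pow _ (hM.abs_exp_neg_lt_one hp hR₀ hR (mul_pos hτ hx))

theorem IsModel.sArg_nonneg (hM : M.IsModel p R P) (hp : p.Valid) (hR₀ : 0 < R 0)
    (hR : StrictMono R) {τ : ℝ} (hτ : 0 < τ) (z : ℕ+) : 0 ≤ M.sArg p R P τ z := by
  have hθ := hM.thetaEff_pos hp hR₀ hR
  have hη := hM.eta_pos hp hR₀ hR
  unfold sArg
  positivity

theorem IsModel.coverageTerm_eq (hM : M.IsModel p R P) (hp : p.Valid) (hR₀ : 0 < R 0)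
    (hR : StrictMono R) {τ : ℝ} (hτ : 0 < τ) (z : ℕ+) :
    M.coverageTerm p R P τ z = ∫ ω, Ring.choose (M.kEff p R P) (z : ℕ) * (-1) ^ ((z : ℕ) + 1) *
      Real.exp (-(M.sArg p R P τ z * M.totalInterf p R ω)) ∂P := by
  rw [integral_const_mul, hM.integral_exp_neg_totalInterf hp hR₀ (hM.sArg_nonneg hp hR₀ hR hτ z),
    coverageTerm, noisePower, mul_add, neg_add, Real.exp_add]
  ring

/-- The series is the average of Alzer's expression over the interference. -/
theorem IsModel.hasSum_coverageTerm (hM : M.IsModel p R P) (hp : p.Valid) (hR₀ : 0 < R 0)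
    (hR : StrictMono R) {τ : ℝ} (hτ : 0 < τ) :
    HasSum (M.coverageTerm p R P τ) (∫ ω, M.alzer p R P (τ * M.Itot p R ω) ∂P) := by
  set F : ℕ+ → Ω → ℝ := fun z ω => Ring.choose (M.kEff p R P) (z : ℕ) * (-1) ^ ((z : ℕ) + 1) *
      Real.exp (-(M.sArg p R P τ z * M.totalInterf p R ω)) with hF
  -- Dominating terms: the interference is replaced by its deterministic lower bound, the noise
  -- power. They are summable because the binomial series converges absolutely there, the base being
  -- less than `1`.
  set B : ℕ+ → ℝ := fun z => |Ring.choose (M.kEff p R P) (z : ℕ) * (-1) ^ ((z : ℕ) + 1) *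
      Real.exp (-(M.sArg p R P τ z * noisePower p))| with hB
  have hBs : Summable B := (hM.hasSum_alzer hp hR₀ hR hτ (noisePower_pos hp)).summable.abs
  have hFB : ∀ z ω, ‖F z ω‖ ≤ B z := fun z ω => by
    simp only [hF, hB, Real.norm_eq_abs]
    rw [abs_mul, abs_mul (Ring.choose _ _ * _) (Real.exp (-(_ * noisePower p))), Real.abs_exp,
      Real.abs_exp]
    refine mul_le_mul_of_nonneg_left (Real.exp_le_exp.2 (neg_le_neg ?_)) (abs_nonneg _)
    exact mul_le_mul_of_nonneg_left (noisePower_le_totalInterf hp hR₀ ω)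
      (hM.sArg_nonneg hp hR₀ hR hτ z)
  have hFi : ∀ z, Integrable (F z) P := fun z => by
    have := hM.measurable_totalInterf
    exact Integrable.of_bound (Measurable.aestronglyMeasurable (by fun_prop)) (B z)
      (ae_of_all _ (hFB z))
  have hsum : Summable fun z => ∫ ω, ‖F z ω‖ ∂P := by
    refine Summable.of_nonneg_of_le (fun z => integral_nonneg fun ω => norm_nonneg _)
      (fun z => ?_) hBs
    calc ∫ ω, ‖F z ω‖ ∂P ≤ ∫ _, B z ∂P :=
          integral_mono (hFi z).norm (integrable_const _) (hFB z)
      _ = B z := by simp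
  have h := hasSum_integral_of_summable_integral_norm hFi hsum
  have h1 : ∫ ω, ∑' z, F z ω ∂P = ∫ ω, M.alzer p R P (τ * M.Itot p R ω) ∂P := by
    refine integral_congr_ae ?_
    filter_upwards [hM.ae_Itot_eq] with ω hω
    rw [hω]
    exact (hM.hasSum_alzer hp hR₀ hR hτ
      ((noisePower_pos hp).trans_le (noisePower_le_totalInterf hp hR₀ ω))).tsum_eq
  rw [h1] at h
  exact h.congr_fun fun z => hM.coverageTerm_eq hp hR₀ hR hτ z

theorem IsModel.integrable_alzer (hM : M.IsModel p R P) (hp : p.Valid) (hR₀ : 0 < R 0)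
    (hR : StrictMono R) {τ : ℝ} (hτ : 0 < τ) :
    Integrable (fun ω => M.alzer p R P (τ * M.Itot p R ω)) P :=
  hM.integrable_comp_Itot hp hR₀ hτ (M.measurable_alzer p R P)
    fun _ hx => hM.abs_alzer_le hp hR₀ hR hx

theorem IsModel.integrable_tail (hM : M.IsModel p R P) (hp : p.Valid) (hR₀ : 0 < R 0)
    {τ : ℝ} (hτ : 0 < τ) {E : Type*} [MeasurableSpace E] (μ : Measure E) [IsProbabilityMeasure μ]
    (X : E → ℝ) : Integrable (fun ω => μ.real {e | τ * M.Itot p R ω < X e}) P :=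
  hM.integrable_comp_Itot hp hR₀ hτ (antitone_measureReal_lt μ X).measurable (C := 1)
    fun _ _ => by rw [abs_of_nonneg measureReal_nonneg]; exact measureReal_le_one

end Network

end CoopSensing

end

/-! ### Coverage, Gamma coverage and the series compared -/

theorem theorem1 {Ω : Type*} [MeasurableSpace Ω] (P : MeasureTheory.Measure Ω)
    [MeasureTheory.IsProbabilityMeasure P] (K : ℕ) (p : CoopSensing.Params) (hp : p.Valid)
    (R : Fin (K + 1) → ℝ) (hR₀ : 0 < R 0) (hR : StrictMono R)
    (M : CoopSensing.Network K Ω) (hM : M.IsModel p R P) (τ : ℝ) (hτ : 0 < τ) :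
    -- the interference sums converge almost surely
    (∀ᵐ ω ∂P, ∀ j, Summable (M.interfTerm p j (M.radius j ω) ω)) ∧
    -- mean and variance of the total echo power
    MemLp (M.Ptot p R) 2 P ∧
    ∫ ω, M.Ptot p R ω ∂P =
      p.muMono (R 0) + ∑ n : Fin K, p.pLit (R n.succ) * p.muBi (R 0) (R n.succ) ∧
    variance (M.Ptot p R) P = p.muMono (R 0) ^ 2 +
      ∑ n : Fin K, p.pLit (R n.succ) * (2 - p.pLit (R n.succ)) * p.muBi (R 0) (R n.succ) ^ 2 ∧
    -- the Gamma law matches both moments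
    0 < M.kEff p R P ∧ 0 < M.thetaEff p R P ∧
    ∫ x, x ∂(M.gammaLaw p R P) = ∫ ω, M.Ptot p R ω ∂P ∧
    variance id (M.gammaLaw p R P) = variance (M.Ptot p R) P ∧
    -- Laplace transforms of the interference
    (∀ s, 0 ≤ s → CoopSensing.laplace P (M.IT p R) s = p.ltTarget K (R 0) s) ∧
    (∀ s, 0 ≤ s → ∀ d, 0 < d →
      CoopSensing.laplace P (M.interf p R .los d) s = Real.exp (-(p.xi * p.JL s d)) ∧
      CoopSensing.laplace P (M.interf p R .nlos d) s = Real.exp (-(p.xi * p.JN s d))) ∧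
    (∀ s, 0 ≤ s →
      CoopSensing.laplace P (fun ω => M.ILS p R ω + M.INS p R ω) s = p.ltDirect s) ∧
    -- the coverage as the average of the tail of the total echo power, and with the Gamma tail
    M.coverage p R P τ = ∫ ω, P.real {ω' | τ * M.Itot p R ω < M.Ptot p R ω'} ∂P ∧
    M.gammaCoverage p R P τ = ∫ ω, (M.gammaLaw p R P).real (Ioi (τ * M.Itot p R ω)) ∂P ∧
    -- Alzer's inequality for the Gamma tail, and the expansion of its right-hand side
    (∀ x, 0 ≤ x →
      (1 ≤ M.kEff p R P → (M.gammaLaw p R P).real (Ioi x) ≤ M.alzer p R P x) ∧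
      (M.kEff p R P ≤ 1 → M.alzer p R P x ≤ (M.gammaLaw p R P).real (Ioi x))) ∧
    (∀ᵐ ω ∂P, HasSum (fun z : ℕ+ => Ring.choose (M.kEff p R P) (z : ℕ) * (-1) ^ ((z : ℕ) + 1) *
        Real.exp (-(M.sArg p R P τ z * M.Itot p R ω))) (M.alzer p R P (τ * M.Itot p R ω))) ∧
    -- the series is the average of Alzer's expression over the interference
    HasSum (M.coverageTerm p R P τ) (∫ ω, M.alzer p R P (τ * M.Itot p R ω) ∂P) ∧
    -- comparison of the series with the coverage for the Gamma law and with the coverage itself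
    (1 ≤ M.kEff p R P → M.gammaCoverage p R P τ ≤ ∑' z : ℕ+, M.coverageTerm p R P τ z) ∧
    (M.kEff p R P ≤ 1 → ∑' z : ℕ+, M.coverageTerm p R P τ z ≤ M.gammaCoverage p R P τ) ∧
    (∀ ε₁ ε₂ : ℝ,
      (∀ x, 0 < x →
        |P.real {ω | x < M.Ptot p R ω} - (M.gammaLaw p R P).real (Ioi x)| ≤ ε₁) →
      (∀ x, 0 < x → |(M.gammaLaw p R P).real (Ioi x) - M.alzer p R P x| ≤ ε₂) →
      |M.coverage p R P τ - ∑' z : ℕ+, M.coverageTerm p R P τ z| ≤ ε₁ + ε₂) := by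
  have hint := hM.integrable_alzer hp hR₀ hR hτ
  have hG := hM.isProbabilityMeasure_gammaLaw hp hR₀ hR
  have hintG : MeasureTheory.Integrable
      (fun ω => (M.gammaLaw p R P).real (Ioi (τ * M.Itot p R ω))) P :=
    hM.integrable_tail hp hR₀ hτ (M.gammaLaw p R P) id
  have hintP := hM.integrable_tail hp hR₀ hτ P (M.Ptot p R)
  have hser := hM.hasSum_coverageTerm hp hR₀ hR hτ
  have hpos := hM.ae_Itot_pos hp hR₀
  have hcov := hM.coverage_eq hp hR₀ τ
  have hgcov := hM.gammaCoverage_eq hp hR₀ hR τ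
  refine ⟨hM.ae_summable hp hR₀, hM.memLp_Ptot hp, hM.integral_Ptot hp, hM.variance_Ptot hp,
    hM.kEff_pos hp hR₀ hR, hM.thetaEff_pos hp hR₀ hR, hM.integral_gammaLaw hp hR₀ hR,
    hM.variance_gammaLaw hp hR₀ hR, fun s hs => hM.laplace_IT hp hR₀ hs,
    fun s hs d hd => ⟨?_, ?_⟩, fun s hs => hM.laplace_ILS_add_INS hp hR₀ hs, hcov, hgcov,
    fun x hx => hM.gammaLaw_tail_alzer hp hR₀ hR hx, ?_, hser, fun hk => ?_, fun hk => ?_,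
    fun ε₁ ε₂ h₁ h₂ => ?_⟩
  · rw [hM.laplace_interf hp hR₀ _ hs hd, CoopSensing.Network.lapExponent_los]
  · rw [hM.laplace_interf hp hR₀ _ hs hd, CoopSensing.Network.lapExponent_nlos]
  · filter_upwards [hpos] with ω hω using hM.hasSum_alzer hp hR₀ hR hτ hω
  · rw [hser.tsum_eq, hgcov]
    refine MeasureTheory.integral_mono_ae hintG hint ?_
    filter_upwards [hpos] with ω hω
    exact (hM.gammaLaw_tail_alzer hp hR₀ hR (mul_pos hτ hω).le).1 hk
  · rw [hser.tsum_eq, hgcov]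
    refine MeasureTheory.integral_mono_ae hint hintG ?_
    filter_upwards [hpos] with ω hω
    exact (hM.gammaLaw_tail_alzer hp hR₀ hR (mul_pos hτ hω).le).2 hk
  · rw [hser.tsum_eq, hcov, ← MeasureTheory.integral_sub hintP hint, ← Real.norm_eq_abs]
    -- Both quantities are averages over the same interference, so the triangle inequality through
    -- the Gamma tail at `τ * Itot > 0` bounds the integrand, and the total mass is `1`.
    refine (MeasureTheory.norm_integral_le_of_norm_le_const (C := ε₁ + ε₂) ?_).trans_eq (by simp)
    filter_upwards [hpos] with ω hω
    exact (abs_sub_le _ _ _).trans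
      (add_le_add (h₁ _ (mul_pos hτ hω)) (h₂ _ (mul_pos hτ hω)))
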